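/- **Transboundary modulus.** For an open set $G\subset\hat{\mathbb C}$ let $\mathcal C(G)$ be the set of connected components of $\hat{\mathbb C}\setminus G$, let $\hat G=G\cup\mathcal C(G)$ be the quotient space obtained from $\hat{\mathbb C}$ by collapsing each $p\in\mathcal C(G)$ to a point, and let $\pi_G:\hat{\mathbb C}\to\hat G$ be the quotient map. For a family $\Gamma$ of paths in $\hat G$, $$\operatorname{mod}(\Gamma)=\inf_\rho\Big(\int_G\rho^2\,dA+\sum_{p\in\mathcal C(G)}\rho(p)^2\Big),$$ the infimum being over all Borel functions $\rho:\hat G\to[0,\infty]$ with $\int_\gamma\rho\,ds+\sum_{p\in\mathcal C(G)\cap|\gamma|}\rho(p)\ge 1$ for every $\gamma\in\Gamma$ whose restriction to $G$ is locally rectifiable; here $\int_\gamma\rho\,ds$ is the path integral over the restriction of $\gamma$ to $G$, and area and length are the Euclidean ones (in $G\setminus\{\infty\}$). For disjoint $A,B\subset\hat{\mathbb C}$ let $\operatorname{mod}(A,B;G)$ be the modulus of the family of all paths in $\hat G$ that join $\pi_G(A)$ and $\pi_G(B)$. **Construction.** Let $(a_k)_{k\ge1},(R_k)_{k\ge1}$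 be decreasing sequences of positive numbers converging to $0$ with $R_1=1$, $R_k<a_k$ and $$\Delta_k:=a_k-(a_{k+1}+R_k+R_{k+1})=2^{-k}R_{k+1}\qquad(k\ge1).$$ Put $T_{k,j}=R_k+2^{-j-1}\Delta_k$, $T_j=a_{j+1}+R_{j+1}+\Delta_j/2$, $$Q_{k,j}=[a_k-T_{k,j},a_k+T_{k,j}]\times[-T_{k,j},T_{k,j}]\ (k\ge1),\qquad Q_{0,j}=[-T_j,T_j]\times[-T_j,T_j].$$ For $m\ge1$ let $M_m\in\mathbb N$ and $0<s_m\le d_m$ satisfy $M_m\ge m2^{m+1}$ and $(M_m-1)s_m+M_md_m=1$. For $1\le\ell\le M_m$ put $$q_{m,\ell}=[(\ell-1)(s_m+d_m),(\ell-1)s_m+\ell d_m]\times[0,d_m].$$ For $1\le k\le m$ let $\phi_{k+1,m}$ be the Möbius transformation that fixes $\infty$ and takes $(0,0)$ and $(1,0)$ to $(a_{k+1}+(1-s_m)T_{k+1,m-1},-R_{k+1})$ and $(a_{k+1}+(1-s_m)T_{k+1,m-1},R_{k+1})$ respectively, and put $$t_{k,m}=(a_k-T_{k,m-1})-(a_{k+1}+(1-2s_m)T_{k+1,m-1})+d_m,$$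 $$q^e_{k+1,m,\ell}=\phi_{k+1,m}(q_{m,\ell}),\qquad q^w_{k,m,\ell}=\phi_{k+1,m}(q_{m,\ell})+(t_{k,m},0).$$ Let $\epsilon(j)$ strictly decrease to $0$, and let $q^e_{k+1,m,\ell,j}$ and $q^w_{k,m,\ell,j}$ be the squares with the same centers as $q^e_{k+1,m,\ell}$ and $q^w_{k,m,\ell}$ and with sidelengths multiplied by $1+\epsilon(j)$. Assume that the numbers $M_m,d_m,s_m,\epsilon(j)$ are chosen so that, for all $1\le\ell\le M_m$, * $q^e_{m+1,m,\ell}\subset\operatorname{int}(Q_{0,m})$; $q^e_{k+1,m,\ell}\subset\operatorname{int}(Q_{k+1,m-1})\setminus Q_{k+1,m}$ for $1\le k\le m-1$; $q^w_{k,m,\ell}\subset\operatorname{int}(Q_{k,m-1})\setminus Q_{k,m}$ for $1\le k\le m$; * for every $j\ge m$ the last two inclusions hold also for $q^e_{k+1,m,\ell,j}$ and $q^w_{k,m,\ell,j}$, and for every $j\ge m+1$ the first one holds also for $q^e_{m+1,m,\ell,j}$; * for every $j\ge1$ the squares $q^e_{k+1,m,\ell,j}$ ($1\le k\le j-1$,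 $k\le m\le j$, $1\le\ell\le M_m$) and $q^w_{k,m,\ell,j}$ ($1\le k\le j$, $k\le m\le j$, $1\le\ell\le M_m$) are pairwise disjoint. For $2\le k\le j$ and $1\le\ell\le M_j$ let $U_{k,j,\ell}\subset\mathbb C$ be a Jordan domain with $\overline U_{k,j,\ell}\subset\operatorname{int}(Q_{k,j-1})\setminus Q_{k,j}$ and $q^e_{k,j,\ell,j}\cup q^w_{k,j,\ell,j}\subset\overline U_{k,j,\ell}$, such that every point of $\partial U_{k,j,\ell}$ with the largest $x$-coordinate among all points of $\partial U_{k,j,\ell}$ lies in $q^e_{k,j,\ell,j}$, and every one with the smallest $x$-coordinate lies in $q^w_{k,j,\ell,j}$. Put $\overline U_{1,j,\ell}:=q^w_{1,j,\ell,j}$. Let $\mathcal P_j$ be the family consisting of * $Q_{0,j}$ and $Q_{k,j}$, $1\le k\le j$; * $q^e_{k+1,m,\ell,j}$ for $1\le k\le j-1$, and $q^w_{k,m,\ell,j}$ for $1\le k\le j$, in both cases for all $k\le m\le j-1$ and $1\le\ell\le M_m$; * $\overline U_{k,j,\ell}$ for $1\le k\le j$, $1\le\ell\le M_j$. Assume that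 for each $j\ge1$ the members of $\mathcal P_j$ are pairwise disjoint, and let $D_j=\hat{\mathbb C}\setminus\bigcup\mathcal P_j$, so that $\mathcal C(D_j)=\mathcal P_j$. **Proposition.** For every such construction, $$\operatorname{mod}(Q_{0,j_0},Q_{1,j_0};D_j)\ \ge\ \frac1{36}\qquad\text{for all integers } j_0\ge1 \text{ and } j\ge j_0.$$ -/

import Mathlib

open Set Filter Topology MeasureTheory
open scoped ENNReal

/-! ### Transboundary modulus -/

namespace Transboundary

/-- The Riemann sphere, as a topological space. -/
abbrev Sphere : Type := OnePoint ℂ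

/-- A planar set as a subset of the sphere. -/
def onSphere (S : Set ℂ) : Set Sphere := (fun z : ℂ => (z : Sphere)) '' S

/-- `x ∼ y` iff `x = y`, or `x` and `y` lie in the same connected component of the complement
of `G`. -/
def collapse (G : Set Sphere) : Setoid Sphere where
  r x y := x = y ∨ (x ∈ Gᶜ ∧ y ∈ connectedComponentIn Gᶜ x)
  iseqv := by
    refine ⟨fun x => Or.inl rfl, ?_, ?_⟩
    · rintro x y (rfl | ⟨hx, hy⟩)
      · exact Or.inl rfl
      · refine Or.inr ⟨connectedComponentIn_subset _ _ hy, ?_⟩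
        rw [← connectedComponentIn_eq hy]
        exact mem_connectedComponentIn hx
    · rintro x y z (rfl | ⟨hx, hy⟩) (rfl | ⟨hy', hz⟩)
      · exact Or.inl rfl
      · exact Or.inr ⟨hy', hz⟩
      · exact Or.inr ⟨hx, hy⟩
      · refine Or.inr ⟨hx, ?_⟩
        rwa [connectedComponentIn_eq hy]

/-- The quotient `Ĝ` of the sphere in which every component of the complement of `G` is
collapsed to a point. -/
def Hat (G : Set Sphere) : Type := Quotient (collapse G)

instance (G : Set Sphere) : TopologicalSpace (Hat G) :=
  inferInstanceAs (TopologicalSpace (Quotient (collapse G)))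

instance (G : Set Sphere) : MeasurableSpace (Hat G) := borel _

instance (G : Set Sphere) : BorelSpace (Hat G) := ⟨rfl⟩

/-- The quotient map `π_G` from the sphere to `Ĝ`. -/
def proj (G : Set Sphere) (x : Sphere) : Hat G := Quotient.mk (collapse G) x

/-- The set `𝒞(G)` of complementary components of `G`, each one seen as a point of `Ĝ`. -/
def components (G : Set Sphere) : Set (Hat G) := proj G '' Gᶜ

/-- The points of `Ĝ` that are finite points of `G`. -/
def finitePart (G : Set Sphere) : Set (Hat G) :=
  {x | ∃ z : ℂ, (z : Sphere) ∈ G ∧ proj G z = x}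

open Classical in
/-- The complex coordinate of a point of `finitePart G` (and `0` elsewhere). -/
noncomputable def coord (G : Set Sphere) (x : Hat G) : ℂ :=
  if h : x ∈ finitePart G then h.choose else 0

/-- A path in `Ĝ`. -/
abbrev HatPath (G : Set Sphere) : Type := C(unitInterval, Hat G)

/-- The parameters at which the path runs in `G` (at a finite point). -/
def timesInside {G : Set Sphere} (γ : HatPath G) : Set unitInterval :=
  γ ⁻¹' finitePart G

/-- The path read in the plane, meaningful on `timesInside γ`. -/
noncomputable def planePath {G : Set Sphere} (γ : HatPath G) : unitInterval → ℂ :=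
  fun t => coord G (γ t)

/-- Local rectifiability of the restriction of `γ` to `G`: every compact subpath that runs in `G`
has finite length. -/
def LocallyRectifiable {G : Set Sphere} (γ : HatPath G) : Prop :=
  ∀ c d : unitInterval, Icc c d ⊆ timesInside γ → eVariationOn (planePath γ) (Icc c d) ≠ ∞

/-- The integral of `ρ` along the rectifiable path `f` restricted to `[c, d]`, through the
arc-length parametrization. -/
noncomputable def arcIntegral (ρ : ℂ → ℝ≥0∞) (f : unitInterval → ℂ) (c d : unitInterval) :
    ℝ≥0∞ :=
  ∫⁻ u in Icc (0 : ℝ) (eVariationOn f (Icc c d)).toReal,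
    ρ (naturalParameterization f (Icc c d) c u)

/-- The path integral `∫_γ ρ ds` of the restriction of `γ` to `G`: the sum, over the components
`J` of the set of parameters at which `γ` runs in `G`, of the integrals along `γ` restricted to
`J`; the latter is the supremum of the integrals over the compact subpaths. -/
noncomputable def lineIntegral {G : Set Sphere} (ρ : Hat G → ℝ≥0∞) (γ : HatPath G) : ℝ≥0∞ :=
  ∑' J : {J : Set unitInterval //
      ∃ t ∈ timesInside γ, J = connectedComponentIn (timesInside γ) t},
    ⨆ (c : unitInterval) (d : unitInterval) (_ : Icc c d ⊆ (J : Set unitInterval)),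
      arcIntegral (fun z => ρ (proj G z)) (planePath γ) c d

/-- The class `X(Γ)` of admissible functions. As usual for line integrals, the condition concerns
the paths that are locally rectifiable in `G`. -/
def Admissible {G : Set Sphere} (Γ : Set (HatPath G)) (ρ : Hat G → ℝ≥0∞) : Prop :=
  Measurable ρ ∧ ∀ γ ∈ Γ, LocallyRectifiable γ →
    1 ≤ lineIntegral ρ γ + ∑' p : ↥(components G ∩ range γ), ρ p

/-- `∫_G ρ² dA + ∑_{p ∈ 𝒞(G)} ρ(p)²`. -/
noncomputable def mass {G : Set Sphere} (ρ : Hat G → ℝ≥0∞) : ℝ≥0∞ :=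
  (∫⁻ z in {z : ℂ | (z : Sphere) ∈ G}, ρ (proj G z) ^ 2) + ∑' p : ↥(components G), ρ p ^ 2

/-- The transboundary modulus of a family of paths in `Ĝ`. -/
noncomputable def modulus {G : Set Sphere} (Γ : Set (HatPath G)) : ℝ≥0∞ :=
  ⨅ (ρ : Hat G → ℝ≥0∞) (_ : Admissible Γ ρ), mass ρ

/-- The family `Γ(A, B; G)` of paths in `Ĝ` that join `π_G(A)` and `π_G(B)`. -/
def joining (A B G : Set Sphere) : Set (HatPath G) :=
  {γ | γ 0 ∈ proj G '' A ∧ γ 1 ∈ proj G '' B}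

/-- `mod(A, B; G)`. -/
noncomputable def modBetween (A B G : Set Sphere) : ℝ≥0∞ := modulus (joining A B G)

end Transboundary

/-! ### The square domains and their complementary pieces -/

namespace SquareDomain

/-- A Jordan domain in the plane: a bounded domain whose boundary is a Jordan curve. -/
def IsJordanDomain (V : Set ℂ) : Prop :=
  IsOpen V ∧ IsConnected V ∧ Bornology.IsBounded V ∧
    ∃ f : Circle → ℂ, Continuous f ∧ Function.Injective f ∧ range f = frontier V

/-- The free choices in the construction; all indices start from `1`. The requirements on them
are collected in `Data.IsConstruction` below. -/
structure Data where
  /-- centres of the squares `Q_k` -/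
  a : ℕ → ℝ
  /-- half sidelengths of the squares `Q_k` -/
  R : ℕ → ℝ
  /-- number of small squares in the columns of generation `m` -/
  M : ℕ → ℕ
  /-- relative sidelength of the small squares of generation `m` -/
  d : ℕ → ℝ
  /-- relative distance of consecutive small squares of generation `m` -/
  s : ℕ → ℝ
  /-- inflation factors -/
  ε : ℕ → ℝ
  /-- the Jordan domains `U_{k,j,ℓ}` -/
  U : ℕ → ℕ → ℕ → Set ℂ

namespace Data

variable (P : Data)

/-- The gap `D_k = a_k - (a_{k+1} + R_k + R_{k+1})` between `Q_k` and `Q_{k+1}`. -/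
def gap (k : ℕ) : ℝ := P.a k - (P.a (k + 1) + P.R k + P.R (k + 1))

/-- `T_{k,j} = R_k + 2^{-j-1} D_k`. -/
noncomputable def T (k j : ℕ) : ℝ := P.R k + (1 / 2) ^ (j + 1) * P.gap k

/-- `T_j = a_{j+1} + R_{j+1} + D_j / 2`. -/
noncomputable def T₀ (j : ℕ) : ℝ := P.a (j + 1) + P.R (j + 1) + P.gap j / 2

/-- The inflated square `Q_{k,j}`, for `k ≥ 1`. -/
def Q (k j : ℕ) : Set ℂ :=
  Icc (P.a k - P.T k j) (P.a k + P.T k j) ×ℂ Icc (-P.T k j) (P.T k j)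

/-- The square `Q_{0,j}`. -/
def Q₀ (j : ℕ) : Set ℂ := Icc (-P.T₀ j) (P.T₀ j) ×ℂ Icc (-P.T₀ j) (P.T₀ j)

/-- The model square `q_{m,ℓ}`, for `ℓ ≥ 1`. -/
def q (m ℓ : ℕ) : Set ℂ :=
  Icc (((ℓ : ℝ) - 1) * (P.s m + P.d m)) (((ℓ : ℝ) - 1) * P.s m + ℓ * P.d m) ×ℂ Icc 0 (P.d m)

/-- The centre of `q_{m,ℓ}`. -/
noncomputable def qCentre (m ℓ : ℕ) : ℂ :=
  ⟨((ℓ : ℝ) - 1) * (P.s m + P.d m) + P.d m / 2, P.d m / 2⟩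

/-- The prescribed image of `0` under `φ_{n,m}`. -/
noncomputable def φ₀ (n m : ℕ) : ℂ := ⟨P.a n + (1 - P.s m) * P.T n (m - 1), -P.R n⟩

/-- The prescribed image of `1` under `φ_{n,m}`. -/
noncomputable def φ₁ (n m : ℕ) : ℂ := ⟨P.a n + (1 - P.s m) * P.T n (m - 1), P.R n⟩

/-- The Möbius transformation `φ_{n,m}` that fixes `∞` and takes the prescribed values at
`0` and `1`, restricted to the plane. -/
noncomputable def φ (n m : ℕ) (z : ℂ) : ℂ := P.φ₀ n m + (P.φ₁ n m - P.φ₀ n m) * z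

/-- The horizontal translation `t_{k,m}`. -/
noncomputable def t (k m : ℕ) : ℝ :=
  (P.a k - P.T k (m - 1)) - (P.a (k + 1) + (1 - 2 * P.s m) * P.T (k + 1) (m - 1)) + P.d m

/-- The squares `q^e_{n,m,ℓ}`, to the right of `Q_n` (`n ≥ 2`). -/
def qe (n m ℓ : ℕ) : Set ℂ := P.φ n m '' P.q m ℓ

/-- The squares `q^w_{k,m,ℓ}`, to the left of `Q_k` (`k ≥ 1`). -/
def qw (k m ℓ : ℕ) : Set ℂ := (fun z => P.φ (k + 1) m z + (P.t k m : ℂ)) '' P.q m ℓ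

/-- `q^e_{n,m,ℓ,j}`: same centre as `q^e_{n,m,ℓ}`, and `1 + ε(j)` times its sidelength. -/
def qeInfl (n m ℓ j : ℕ) : Set ℂ :=
  AffineMap.homothety (P.φ n m (P.qCentre m ℓ)) (1 + P.ε j) '' P.qe n m ℓ

/-- `q^w_{k,m,ℓ,j}`: same centre as `q^w_{k,m,ℓ}`, and `1 + ε(j)` times its sidelength. -/
def qwInfl (k m ℓ j : ℕ) : Set ℂ :=
  AffineMap.homothety (P.φ (k + 1) m (P.qCentre m ℓ) + (P.t k m : ℂ)) (1 + P.ε j) '' P.qw k m ℓ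

/-- The closed set `Ū_{k,j,ℓ}`; for `k = 1` it is the square `q^w_{1,j,ℓ,j}`. -/
def Ubar (k j ℓ : ℕ) : Set ℂ := if k = 1 then P.qwInfl 1 j ℓ j else closure (P.U k j ℓ)

/-- Labels for the pieces of the complement of `D_j`. -/
inductive Label where
  /-- the square `Q_{0,j}` -/
  | centre : Label
  /-- the square `Q_{k,j}` -/
  | core (k : ℕ) : Label
  /-- the square `q^e_{n,m,ℓ,j}` -/
  | east (n m ℓ : ℕ) : Label
  /-- the square `q^w_{k,m,ℓ,j}` -/
  | west (k m ℓ : ℕ) : Label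
  /-- the set `Ū_{k,j,ℓ}` -/
  | chain (k ℓ : ℕ) : Label

/-- The set with a given label at stage `j`. -/
def piece (j : ℕ) : Label → Set ℂ
  | .centre => P.Q₀ j
  | .core k => P.Q k j
  | .east n m ℓ => P.qeInfl n m ℓ j
  | .west k m ℓ => P.qwInfl k m ℓ j
  | .chain k ℓ => P.Ubar k j ℓ

/-- The labels of the inflated small squares of stage `j` and of generation at most `N`. With
`n = k + 1` the first case reads `1 ≤ k ≤ j - 1`, `k ≤ m ≤ N`. -/
def smallLabels (j N : ℕ) : Set Label :=
  {i | (∃ n m ℓ, i = .east n m ℓ ∧ 2 ≤ n ∧ n ≤ j ∧ n ≤ m + 1 ∧ m ≤ N ∧ 1 ≤ ℓ ∧ ℓ ≤ P.M m) ∨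
    (∃ k m ℓ, i = .west k m ℓ ∧ 1 ≤ k ∧ k ≤ j ∧ k ≤ m ∧ m ≤ N ∧ 1 ≤ ℓ ∧ ℓ ≤ P.M m)}

/-- The labels of the complementary components of `D_j`. -/
def labels (j : ℕ) : Set Label :=
  {i | i = .centre ∨ (∃ k, i = .core k ∧ 1 ≤ k ∧ k ≤ j) ∨ i ∈ P.smallLabels j (j - 1) ∨
    (∃ k ℓ, i = .chain k ℓ ∧ 1 ≤ k ∧ k ≤ j ∧ 1 ≤ ℓ ∧ ℓ ≤ P.M j)}

/-- The domain `D_j` of the exhaustion: the complement in the sphere of all pieces of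
stage `j`. -/
def Dom (j : ℕ) : Set Transboundary.Sphere :=
  (Transboundary.onSphere (⋃ i ∈ P.labels j, P.piece j i))ᶜ

/-- The requirements on the choices made in the construction. -/
structure IsConstruction : Prop where
  -- the squares `Q_k`
  a_anti : AntitoneOn P.a (Ici 1)
  R_anti : AntitoneOn P.R (Ici 1)
  a_lim : Tendsto P.a atTop (𝓝 0)
  R_lim : Tendsto P.R atTop (𝓝 0)
  R_one : P.R 1 = 1
  R_pos : ∀ k, 1 ≤ k → 0 < P.R k
  R_lt_a : ∀ k, 1 ≤ k → P.R k < P.a k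
  gap_eq : ∀ k, 1 ≤ k → P.gap k = (1 / 2) ^ k * P.R (k + 1)
  -- the model squares
  d_pos : ∀ m, 1 ≤ m → 0 < P.d m
  s_pos : ∀ m, 1 ≤ m → 0 < P.s m
  s_le_d : ∀ m, 1 ≤ m → P.s m ≤ P.d m
  total : ∀ m, 1 ≤ m → ((P.M m : ℝ) - 1) * P.s m + P.M m * P.d m = 1
  -- `M_m` is large
  M_large : ∀ m, 1 ≤ m → m * 2 ^ (m + 1) ≤ P.M m
  qe_sub_centre : ∀ m ℓ, 1 ≤ m → 1 ≤ ℓ → ℓ ≤ P.M m → P.qe (m + 1) m ℓ ⊆ interior (P.Q₀ m)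
  qe_sub : ∀ n m ℓ, 2 ≤ n → n ≤ m → 1 ≤ ℓ → ℓ ≤ P.M m →
    P.qe n m ℓ ⊆ interior (P.Q n (m - 1)) \ P.Q n m
  qw_sub : ∀ k m ℓ, 1 ≤ k → k ≤ m → 1 ≤ ℓ → ℓ ≤ P.M m →
    P.qw k m ℓ ⊆ interior (P.Q k (m - 1)) \ P.Q k m
  -- the inflation factors
  ε_anti : StrictAntiOn P.ε (Ici 1)
  ε_lim : Tendsto P.ε atTop (𝓝 0)
  small_disjoint : ∀ j, 1 ≤ j → (P.smallLabels j j).PairwiseDisjoint (P.piece j)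
  qeInfl_sub_centre : ∀ m ℓ j, 1 ≤ m → m + 1 ≤ j → 1 ≤ ℓ → ℓ ≤ P.M m →
    P.qeInfl (m + 1) m ℓ j ⊆ interior (P.Q₀ m)
  qeInfl_sub : ∀ n m ℓ j, 2 ≤ n → n ≤ m → m ≤ j → 1 ≤ ℓ → ℓ ≤ P.M m →
    P.qeInfl n m ℓ j ⊆ interior (P.Q n (m - 1)) \ P.Q n m
  qwInfl_sub : ∀ k m ℓ j, 1 ≤ k → k ≤ m → m ≤ j → 1 ≤ ℓ → ℓ ≤ P.M m →
    P.qwInfl k m ℓ j ⊆ interior (P.Q k (m - 1)) \ P.Q k m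
  -- the Jordan domains
  U_jordan : ∀ k j ℓ, 2 ≤ k → k ≤ j → 1 ≤ ℓ → ℓ ≤ P.M j → IsJordanDomain (P.U k j ℓ)
  U_sub : ∀ k j ℓ, 2 ≤ k → k ≤ j → 1 ≤ ℓ → ℓ ≤ P.M j →
    closure (P.U k j ℓ) ⊆ interior (P.Q k (j - 1)) \ P.Q k j
  qe_sub_U : ∀ k j ℓ, 2 ≤ k → k ≤ j → 1 ≤ ℓ → ℓ ≤ P.M j →
    P.qeInfl k j ℓ j ⊆ closure (P.U k j ℓ)
  qw_sub_U : ∀ k j ℓ, 2 ≤ k → k ≤ j → 1 ≤ ℓ → ℓ ≤ P.M j →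
    P.qwInfl k j ℓ j ⊆ closure (P.U k j ℓ)
  U_rightmost : ∀ k j ℓ, 2 ≤ k → k ≤ j → 1 ≤ ℓ → ℓ ≤ P.M j → ∀ z ∈ frontier (P.U k j ℓ),
    (∀ w ∈ frontier (P.U k j ℓ), w.re ≤ z.re) → z ∈ P.qeInfl k j ℓ j
  U_leftmost : ∀ k j ℓ, 2 ≤ k → k ≤ j → 1 ≤ ℓ → ℓ ≤ P.M j → ∀ z ∈ frontier (P.U k j ℓ),
    (∀ w ∈ frontier (P.U k j ℓ), z.re ≤ w.re) → z ∈ P.qwInfl k j ℓ j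
  -- the pieces of stage `j` are pairwise disjoint, so that they are the complementary
  -- components of `D_j`
  pieces_disjoint : ∀ j, 1 ≤ j → (P.labels j).PairwiseDisjoint (P.piece j)

end Data

end SquareDomain

/-! The proof is a length–area argument with one path for each of many relative heights. In the gap
between $Q_{k+1}$ and $Q_k$ a relative height $t\in[0,1]$ is read as the height
$-R_{k+1}+2R_{k+1}t$. The path for $t$ starts on the right side of $Q_{0,j}$, crosses gap $j$
horizontally, and ends its segment in a west square of generation $j$. That square lies in some
$\overline U_{j,j,\ell}$, and so does the east square with the same index on the other side of
$Q_j$. In the quotient $\overline U_{j,j,\ell}$ is one point, so the path can resume in gap $j-1$ at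
the same relative height, and so on until it reaches $Q_{1,j}$. This works for $t$ in `goodHeights`,
the heights covered by the uninflated squares of generation $j$, whose measure is at least $1/2$
because $s_j\le d_j$ (`exists_joining_path`, `volume_goodHeights_ge`).

Admissibility of $\rho$ is integrated over these $t$, and Young's inequality $xy\le 9cx^2+y^2/(36c)$
is applied to each term (`ennreal_mul_le_sq`). Gap $k$ has width $2^{-k}R_{k+1}$ and its heights
scale by $2R_{k+1}$, so the gaps give at most $9\int\rho^2$ plus $\frac1{72}\sum_k 2^{-k}$
(`sum_lintegral_segments_le`). A component $p$ that is met for a set of $t$ of measure at most $w_p$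
gives at most $9\rho(p)^2+w_p^2/36$. Here $w_p$ is $1$ for $Q_0$ and $Q_1$ and at most $2d_m$ for
pieces of generation $m$. Since $M_md_m\le1$ and $M_m\ge m2^{m+1}$, the sum of the $w_p^2$ is at
most $7$ (`sum_weight_sq_le`). Altogether $\frac12\le 9\operatorname{mass}(\rho)+\frac14$, uniformly
in $j$ (`half_le_mass`).

The geometric core is `mem_hitSet`: each piece is met only at its own range of relative heights. The
critical case is that of the sets $\overline U$, whose shape is arbitrary. Their extreme points to
the right and left lie in the small squares, and the segments begin and end at the outer sides of
those squares, so elsewhere $\overline U$ cannot reach a segment. -/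

namespace Transboundary

/-! ### The quotient in which complementary components become points -/

section Hat

variable {G : Set Sphere}

theorem proj_eq_iff {x y : Sphere} :
    proj G x = proj G y ↔ x = y ∨ (x ∈ Gᶜ ∧ y ∈ connectedComponentIn Gᶜ x) :=
  Quotient.eq (r := collapse G)

theorem proj_eq_iff_of_mem {x y : Sphere} (hx : x ∈ G) : proj G x = proj G y ↔ x = y := by
  rw [proj_eq_iff]
  constructor
  · rintro (h | ⟨h, -⟩)
    · exact h
    · exact absurd hx h
  · exact Or.inl

theorem proj_mem_components_iff {x : Sphere} : proj G x ∈ components G ↔ x ∉ G := by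
  constructor
  · rintro ⟨y, hy, hxy⟩ hx
    exact hy (((proj_eq_iff_of_mem hx).1 hxy.symm) ▸ hx)
  · exact fun h => ⟨x, h, rfl⟩

theorem proj_coe_mem_finitePart_iff {z : ℂ} :
    proj G (z : Sphere) ∈ finitePart G ↔ (z : Sphere) ∈ G := by
  constructor
  · rintro ⟨w, hw, hwz⟩
    exact ((proj_eq_iff_of_mem hw).1 hwz) ▸ hw
  · exact fun h => ⟨z, h, rfl⟩

theorem coord_proj {z : ℂ} (hz : (z : Sphere) ∈ G) : coord G (proj G (z : Sphere)) = z := by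
  have h : proj G (z : Sphere) ∈ finitePart G := proj_coe_mem_finitePart_iff.2 hz
  rw [coord, dif_pos h]
  have := h.choose_spec
  exact OnePoint.coe_injective ((proj_eq_iff_of_mem this.1).1 this.2)

theorem continuous_proj (G : Set Sphere) : Continuous (proj G) := continuous_quotient_mk'

theorem proj_eq_of_isPreconnected {S : Set Sphere} (hS : IsPreconnected S) (hSG : S ⊆ Gᶜ)
    {x y : Sphere} (hx : x ∈ S) (hy : y ∈ S) : proj G x = proj G y :=
  proj_eq_iff.2 (Or.inr ⟨hSG hx, hS.subset_connectedComponentIn hx hSG hy⟩)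

/-- If the complement of `G` splits into two disjoint closed sets, then points of different parts
lie in different components. -/
theorem proj_ne_of_closed_separation {K L : Set Sphere} (hK : IsClosed K) (hL : IsClosed L)
    (hKL : Disjoint K L) (hG : Gᶜ ⊆ K ∪ L) {x y : Sphere} (hx : x ∈ K) (hy : y ∈ L) :
    proj G x ≠ proj G y := by
  intro h
  rcases proj_eq_iff.1 h with rfl | ⟨hxG, hyx⟩
  · exact hKL.le_bot ⟨hx, hy⟩
  · have hpre : IsPreconnected (connectedComponentIn Gᶜ x) := isPreconnected_connectedComponentIn
    obtain ⟨z, -, hz⟩ := isPreconnected_closed_iff.1 hpre K L hK hL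
      ((connectedComponentIn_subset _ _).trans hG)
      ⟨x, mem_connectedComponentIn hxG, hx⟩ ⟨y, hyx, hy⟩
    exact hKL.le_bot hz

end Hat

/-! ### Paths made of horizontal segments and their line integrals -/

section Segments

/-- The horizontal line of height `h`. -/
def hline (h x : ℝ) : ℂ := ⟨x, h⟩

theorem isometry_hline (h : ℝ) : Isometry (hline h) :=
  Isometry.of_dist_eq fun x y => by
    exact Complex.dist_of_im_eq (z := hline h x) (w := hline h y) rfl

theorem eVariationOn_isometry_comp {α E F : Type*} [LinearOrder α] [PseudoEMetricSpace E]
    [PseudoEMetricSpace F] {L : E → F} (hL : Isometry L) (f : α → E) (s : Set α) :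
    eVariationOn (fun u => L (f u)) s = eVariationOn f s := by
  simp only [eVariationOn, hL.edist_eq]

theorem eVariationOn_Icc_of_monotoneOn {α : Type*} [LinearOrder α] {X : α → ℝ} {c d : α}
    (hX : MonotoneOn X (Icc c d)) (hcd : c ≤ d) :
    eVariationOn X (Icc c d) = ENNReal.ofReal (X d - X c) := by
  have := hX.eVariationOn_eq (left_mem_Icc.2 hcd) (right_mem_Icc.2 hcd)
  rwa [inter_self] at this

theorem eVariationOn_hline {f : unitInterval → ℂ} {X : unitInterval → ℝ} {c d : unitInterval}
    {h : ℝ} (hX : Monotone X) (hf : ∀ u ∈ Icc c d, f u = hline h (X u)) (hcd : c ≤ d) :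
    eVariationOn f (Icc c d) = ENNReal.ofReal (X d - X c) := by
  rw [eVariationOn.congr (g := fun u => hline h (X u)) hf,
    eVariationOn_isometry_comp (isometry_hline h),
    eVariationOn_Icc_of_monotoneOn (hX.monotoneOn _) hcd]

/-- Along a monotone horizontal path arc length is the increase of the abscissa, so the natural
parametrization is a translation of the line and the integral becomes an ordinary one in $x$. -/
theorem arcIntegral_hline (ρ : ℂ → ℝ≥0∞) {f : unitInterval → ℂ} {X : unitInterval → ℝ}
    {c d : unitInterval} {h : ℝ} (hX : Monotone X) (hXc : Continuous X)
    (hf : ∀ u ∈ Icc c d, f u = hline h (X u)) (hcd : c ≤ d) :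
    arcIntegral ρ f c d = ∫⁻ x in Icc (X c) (X d), ρ (hline h x) := by
  have hle : X c ≤ X d := hX hcd
  have key : ∀ u ∈ Icc (0 : ℝ) (X d - X c),
      naturalParameterization f (Icc c d) c u = hline h (X c + u) := by
    intro u hu
    have hvar : ∀ v ∈ Icc c d, variationOnFromTo f (Icc c d) c v = X v - X c := by
      intro v hv
      have hsub : Icc c d ∩ Icc c v = Icc c v :=
        inter_eq_right.2 (Icc_subset_Icc_right hv.2)
      rw [variationOnFromTo, if_pos hv.1, hsub,
        eVariationOn_hline hX (fun w hw => hf w ⟨hw.1, hw.2.trans hv.2⟩) hv.1,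
        ENNReal.toReal_ofReal (sub_nonneg.2 (hX hv.1))]
    obtain ⟨v, hv, hvu⟩ : X c + u ∈ X '' Icc c d :=
      intermediate_value_Icc hcd hXc.continuousOn
        ⟨by linarith [hu.1], by linarith [hu.2]⟩
    have hex : ∃ v ∈ Icc c d, variationOnFromTo f (Icc c d) c v = u :=
      ⟨v, hv, by rw [hvar v hv, hvu]; ring⟩
    have hne : Nonempty unitInterval := ⟨c⟩
    -- The parameter picked by `invFunOn` need not be unique when `X` is constant on intervals, but
    -- its abscissa is determined, and only that matters.
    have hmem := Function.invFunOn_mem hex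
    have heq := Function.invFunOn_eq hex
    rw [hvar _ hmem] at heq
    show f (Function.invFunOn (variationOnFromTo f (Icc c d) c) (Icc c d) u) = _
    rw [hf _ hmem]
    congr 1
    linarith
  rw [arcIntegral, eVariationOn_hline hX hf hcd, ENNReal.toReal_ofReal (sub_nonneg.2 hle),
    setLIntegral_congr_fun measurableSet_Icc (fun u hu => congrArg ρ (key u hu))]
  have hmp : MeasurePreserving (fun u : ℝ => X c + u) volume volume :=
    measurePreserving_add_left volume (X c)
  have hemb : MeasurableEmbedding (fun u : ℝ => X c + u) := measurableEmbedding_addLeft (X c)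
  have := hmp.setLIntegral_comp_preimage_emb hemb (fun x => ρ (hline h x)) (Icc (X c) (X d))
  rw [← this]
  congr 2
  ext u
  simp only [mem_preimage, mem_Icc]
  constructor <;> rintro ⟨h1, h2⟩ <;> constructor <;> linarith

theorem arcIntegral_of_lt (ρ : ℂ → ℝ≥0∞) (f : unitInterval → ℂ) {c d : unitInterval}
    (hdc : d < c) : arcIntegral ρ f c d = 0 := by
  rw [arcIntegral, Icc_eq_empty (not_le.2 hdc), eVariationOn.subsingleton f subsingleton_empty]
  simp

/-- A map of the line into `Ĝ` that follows finitely many horizontal segments and rests between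
two consecutive ones, which have their end and starting points in the same component. -/
theorem exists_segment_chain {G : Set Sphere} (α β h : ℕ → ℝ) (n : ℕ)
    (hαβ : ∀ i ≤ n, α i ≤ β i) (hβα : ∀ i < n, β i < α (i + 1))
    (hjoin : ∀ i < n, proj G (hline (h i) (β i) : Sphere)
      = proj G (hline (h (i + 1)) (α (i + 1)) : Sphere)) :
    ∃ g : ℝ → Hat G, Continuous g ∧
      (∀ i ≤ n, ∀ x ∈ Icc (α i) (β i), g x = proj G (hline (h i) x : Sphere)) ∧
      ∀ i < n, ∀ x ∈ Icc (β i) (α (i + 1)), g x = proj G (hline (h i) (β i) : Sphere) := by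
  have hcont : ∀ y : ℝ, Continuous fun x : ℝ => proj G (hline y x : Sphere) := fun y =>
    (continuous_proj G).comp (OnePoint.continuous_coe.comp (isometry_hline y).continuous)
  induction n with
  | zero =>
    refine ⟨fun x => proj G (hline (h 0) x : Sphere), hcont _, ?_, ?_⟩
    · intro i hi x _
      obtain rfl : i = 0 := by omega
      rfl
    · intro i hi
      omega
  | succ n ih =>
    obtain ⟨g, hg, hseg, hrest⟩ := ih (fun i hi => hαβ i (by omega)) (fun i hi => hβα i (by omega))
      (fun i hi => hjoin i (by omega))
    have hβmono : ∀ i ≤ n, β i ≤ β n := by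
      intro i hi
      induction hi using Nat.decreasingInduction with
      | self => exact le_rfl
      | of_succ k hk ihk =>
        exact ((hβα k (by omega)).le.trans (hαβ (k + 1) (by omega))).trans ihk
    have hlt := hβα n (by omega)
    -- On the interval between two segments the new map is constant. Continuity at both ends is the
    -- condition `hjoin` together with the value of `g` at `β n`.
    refine ⟨fun x => if x ≤ β n then g x else if x ≤ α (n + 1) then
      proj G (hline (h n) (β n) : Sphere) else proj G (hline (h (n + 1)) x : Sphere), ?_, ?_, ?_⟩
    · refine hg.if_le (Continuous.if_le continuous_const (hcont _) continuous_id continuous_const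
        ?_) continuous_id continuous_const ?_
      · rintro x rfl
        exact hjoin n (by omega)
      · rintro x rfl
        rw [if_pos hlt.le]
        exact hseg n le_rfl _ (right_mem_Icc.2 (hαβ n (by omega)))
    · intro i hi x hx
      beta_reduce
      rcases Nat.lt_or_ge n i with hni | hni
      · obtain rfl : i = n + 1 := by omega
        rw [if_neg (not_le.2 (hlt.trans_le hx.1))]
        split_ifs with hxα
        · obtain rfl : x = α (n + 1) := le_antisymm hxα hx.1
          exact hjoin n (by omega)
        · rfl
      · rw [if_pos (hx.2.trans (hβmono i hni))]
        exact hseg i hni x hx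
    · intro i hi x hx
      beta_reduce
      rcases Nat.lt_or_ge i n with hin | hin
      · rw [if_pos ((hx.2.trans (hαβ (i + 1) (by omega))).trans (hβmono (i + 1) (by omega)))]
        exact hrest i hin x hx
      · obtain rfl : i = n := by omega
        split_ifs with h1 h2
        · obtain rfl : x = β i := le_antisymm h1 hx.1
          exact hseg i le_rfl _ (right_mem_Icc.2 (hαβ i (by omega)))
        · rfl
        · exact absurd hx.2 h2

theorem exists_mem_segment {α β : ℕ → ℝ} {n : ℕ} {x : ℝ} (hx : x ∈ Icc (α 0) (β n)) :
    (∃ i ≤ n, x ∈ Icc (α i) (β i)) ∨ ∃ i < n, x ∈ Icc (β i) (α (i + 1)) := by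
  induction n with
  | zero => exact Or.inl ⟨0, le_rfl, hx⟩
  | succ n ih =>
    rcases le_total x (β n) with h1 | h1
    · rcases ih ⟨hx.1, h1⟩ with ⟨i, hi, h⟩ | ⟨i, hi, h⟩
      · exact Or.inl ⟨i, by omega, h⟩
      · exact Or.inr ⟨i, by omega, h⟩
    · rcases le_total x (α (n + 1)) with h2 | h2
      · exact Or.inr ⟨n, by omega, h1, h2⟩
      · exact Or.inl ⟨n + 1, le_rfl, h2, hx.2⟩

/-- The sum is a supremum of finite sums, so the index set need not be countable. -/
theorem tsum_setLIntegral_le {ι : Type*} {S : ι → Set ℝ} (hS : ∀ i, MeasurableSet (S i))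
    (hd : Pairwise (Function.onFun Disjoint S)) (F : ℝ → ℝ≥0∞) :
    ∑' i, ∫⁻ x in S i, F x ≤ ∫⁻ x, F x := by
  rw [ENNReal.tsum_eq_iSup_sum]
  refine iSup_le fun s => ?_
  rw [← lintegral_biUnion_finset (hd.set_pairwise _) fun i _ => hS i]
  exact setLIntegral_le_lintegral _ _

/-- The path in `Ĝ` along finitely many horizontal segments, with the bound for its line integral
and the list of the components that it meets. -/
theorem exists_path_of_segments {G : Set Sphere} (α β h : ℕ → ℝ) (n : ℕ)
    (hαβ : ∀ i ≤ n, α i ≤ β i) (hβα : ∀ i < n, β i < α (i + 1)) (hlt : α 0 < β n)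
    (hjoin : ∀ i < n, proj G (hline (h i) (β i) : Sphere)
      = proj G (hline (h (i + 1)) (α (i + 1)) : Sphere))
    (hout : ∀ i < n, (hline (h i) (β i) : Sphere) ∉ G)
    (hG : MeasurableSet {z : ℂ | (z : Sphere) ∈ G}) :
    ∃ γ : HatPath G, γ 0 = proj G (hline (h 0) (α 0) : Sphere) ∧
      γ 1 = proj G (hline (h n) (β n) : Sphere) ∧ LocallyRectifiable γ ∧
      (∀ ρ : Hat G → ℝ≥0∞, Measurable ρ → lineIntegral ρ γ ≤ ∑ i ∈ Finset.range (n + 1),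
        ∫⁻ x in Icc (α i) (β i),
          {z : ℂ | (z : Sphere) ∈ G}.indicator (fun z => ρ (proj G z)) (hline (h i) x)) ∧
      ∀ p ∈ components G ∩ range γ, ∃ i ≤ n, ∃ x ∈ Icc (α i) (β i),
        (hline (h i) x : Sphere) ∉ G ∧ p = proj G (hline (h i) x : Sphere) := by
  obtain ⟨g, hg, hseg, hrest⟩ := exists_segment_chain α β h n hαβ hβα hjoin
  set X : unitInterval → ℝ := fun u => α 0 + (β n - α 0) * u with hXdef
  have hXc : Continuous X := by fun_prop
  have hXm : StrictMono X := fun u v huv => by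
    have : (u : ℝ) < v := huv
    have := mul_lt_mul_of_pos_left this (sub_pos.2 hlt)
    simp only [hXdef]; linarith
  have hX0 : X 0 = α 0 := by simp [hXdef]
  have hX1 : X 1 = β n := by simp [hXdef]
  have hXI : ∀ u, X u ∈ Icc (α 0) (β n) := fun u =>
    ⟨hX0 ▸ hXm.monotone unitInterval.nonneg', hX1 ▸ hXm.monotone unitInterval.le_one'⟩
  set γ : HatPath G := ⟨fun u => g (X u), hg.comp hXc⟩ with hγ
  have hγu : ∀ u, γ u = g (X u) := fun _ => rfl
  -- a parameter inside lies over one of the segments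
  have hinside : ∀ u ∈ timesInside γ, ∃ i ≤ n, X u ∈ Icc (α i) (β i) ∧
      (hline (h i) (X u) : Sphere) ∈ G := by
    intro u hu
    have hu' : g (X u) ∈ finitePart G := hu
    rcases exists_mem_segment (hXI u) with ⟨i, hi, hx⟩ | ⟨i, hi, hx⟩
    · rw [hseg i hi _ hx, proj_coe_mem_finitePart_iff] at hu'
      exact ⟨i, hi, hx, hu'⟩
    · rw [hrest i hi _ hx, proj_coe_mem_finitePart_iff] at hu'
      exact absurd hu' (hout i hi)
  -- A subpath inside the domain lies over a single segment: to leave segment `i` it would have to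
  -- pass its end `β i`, which for `i < n` is outside `G`.
  have hsub : ∀ c d, c ≤ d → Icc c d ⊆ timesInside γ → ∃ i ≤ n, ∀ u ∈ Icc c d,
      X u ∈ Icc (α i) (β i) ∧ (hline (h i) (X u) : Sphere) ∈ G ∧
        planePath γ u = hline (h i) (X u) := by
    intro c d hcd hI
    obtain ⟨i, hi, hci, -⟩ := hinside c (hI (left_mem_Icc.2 hcd))
    have hd : X d ≤ β i := by
      by_contra! hlt'
      rcases hi.lt_or_eq with hin | rfl
      · obtain ⟨v, hv, hvx⟩ := intermediate_value_Icc hcd hXc.continuousOn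
          (show β i ∈ Icc (X c) (X d) from ⟨hci.2, hlt'.le⟩)
        have hv' : g (X v) ∈ finitePart G := hI hv
        rw [hvx, hseg i hi _ (right_mem_Icc.2 (hαβ i hi)), proj_coe_mem_finitePart_iff] at hv'
        exact hout i hin hv'
      · exact absurd (hXI d).2 (not_le.2 hlt')
    refine ⟨i, hi, fun u hu => ?_⟩
    have hx : X u ∈ Icc (α i) (β i) :=
      ⟨hci.1.trans (hXm.monotone hu.1), (hXm.monotone hu.2).trans hd⟩
    have hu' : g (X u) ∈ finitePart G := hI hu
    rw [hseg i hi _ hx, proj_coe_mem_finitePart_iff] at hu'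
    refine ⟨hx, hu', ?_⟩
    rw [planePath, hγu, hseg i hi _ hx, coord_proj hu']
  refine ⟨γ, ?_, ?_, ?_, ?_, ?_⟩
  · rw [hγu, hX0]
    exact hseg 0 (Nat.zero_le _) _ (left_mem_Icc.2 (hαβ 0 (Nat.zero_le _)))
  · rw [hγu, hX1]
    exact hseg n le_rfl _ (right_mem_Icc.2 (hαβ n le_rfl))
  · intro c d hI
    rcases le_or_gt c d with hcd | hcd
    · obtain ⟨i, -, hu⟩ := hsub c d hcd hI
      rw [eVariationOn_hline hXm.monotone (fun u hu' => (hu u hu').2.2) hcd]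
      exact ENNReal.ofReal_ne_top
    · rw [Icc_eq_empty (not_le.2 hcd), eVariationOn.subsingleton _ subsingleton_empty]
      exact ENNReal.zero_ne_top
  · intro ρ hρ
    set f : ℕ → ℝ → ℝ≥0∞ := fun i x =>
      {z : ℂ | (z : Sphere) ∈ G}.indicator (fun z => ρ (proj G z)) (hline (h i) x) with hf
    have hfm : ∀ i, Measurable (f i) := fun i =>
      ((hρ.comp ((continuous_proj G).comp OnePoint.continuous_coe).measurable).indicator hG).comp
        (isometry_hline (h i)).continuous.measurable
    -- One function on the line dominates the integrand of all subpaths. The components of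
    -- `timesInside γ` have disjoint images under the injective `X`, so their integrals add up to at
    -- most that of `F`.
    set F : ℝ → ℝ≥0∞ := fun x =>
      ∑ i ∈ Finset.range (n + 1), (Icc (α i) (β i)).indicator (f i) x with hF
    have hFint : ∫⁻ x, F x = ∑ i ∈ Finset.range (n + 1), ∫⁻ x in Icc (α i) (β i), f i x := by
      rw [lintegral_finsetSum _ fun i _ => (hfm i).indicator measurableSet_Icc]
      exact Finset.sum_congr rfl fun i _ => lintegral_indicator measurableSet_Icc _
    rw [← hFint]
    have harc : ∀ c d, Icc c d ⊆ timesInside γ →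
        arcIntegral (fun z => ρ (proj G z)) (planePath γ) c d ≤ ∫⁻ x in X '' Icc c d, F x := by
      intro c d hI
      rcases le_or_gt c d with hcd | hcd
      · obtain ⟨i, hi, hu⟩ := hsub c d hcd hI
        have himg : Icc (X c) (X d) ⊆ X '' Icc c d :=
          intermediate_value_Icc hcd hXc.continuousOn
        rw [arcIntegral_hline _ hXm.monotone hXc (fun u hu' => (hu u hu').2.2) hcd]
        refine (setLIntegral_mono' measurableSet_Icc fun x hx => ?_).trans
          (lintegral_mono_set himg)
        obtain ⟨u, hu', rfl⟩ := himg hx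
        obtain ⟨h1, h2, -⟩ := hu u hu'
        have : ρ (proj G (hline (h i) (X u) : Sphere))
            = (Icc (α i) (β i)).indicator (f i) (X u) := by
          rw [indicator_of_mem h1]
          exact (indicator_of_mem (s := {z : ℂ | (z : Sphere) ∈ G}) h2
            (fun z => ρ (proj G (z : Sphere)))).symm
        rw [this]
        exact Finset.single_le_sum
          (f := fun i => (Icc (α i) (β i)).indicator (f i) (X u)) (fun _ _ => zero_le)
          (Finset.mem_range.2 (Nat.lt_succ_of_le hi))
      · rw [arcIntegral_of_lt _ _ hcd]
        exact zero_le
    have hle : lineIntegral ρ γ ≤ ∑' J : {J : Set unitInterval //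
        ∃ t ∈ timesInside γ, J = connectedComponentIn (timesInside γ) t},
        ∫⁻ x in X '' (J : Set unitInterval), F x := by
      refine ENNReal.tsum_le_tsum ?_
      rintro ⟨J, t, ht, rfl⟩
      refine iSup_le fun c => iSup_le fun d => iSup_le fun hI => ?_
      exact (harc c d (hI.trans (connectedComponentIn_subset _ _))).trans
        (lintegral_mono_set (image_mono hI))
    refine hle.trans (tsum_setLIntegral_le ?_ ?_ F)
    · rintro ⟨J, t, ht, rfl⟩
      exact (isPreconnected_connectedComponentIn.image X hXc.continuousOn).ordConnected.measurableSet
    · rintro ⟨J, t, ht, rfl⟩ ⟨J', t', ht', rfl⟩ hne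
      refine (disjoint_image_iff hXm.injective).2 ?_
      rw [Set.disjoint_left]
      intro u hu hu'
      exact hne (Subtype.ext ((connectedComponentIn_eq hu).trans (connectedComponentIn_eq hu').symm))
  · rintro p ⟨hp, u, rfl⟩
    rw [hγu] at hp ⊢
    rcases exists_mem_segment (hXI u) with ⟨i, hi, hx⟩ | ⟨i, hi, hx⟩
    · rw [hseg i hi _ hx] at hp ⊢
      exact ⟨i, hi, _, hx, proj_mem_components_iff.1 hp, rfl⟩
    · rw [hrest i hi _ hx]
      exact ⟨i, hi.le, _, right_mem_Icc.2 (hαβ i hi.le), hout i hi, rfl⟩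

end Segments

end Transboundary

/-! ### Geometry of the construction -/

namespace SquareDomain

theorem mem_frontier_of_isMaxOn {U : Set ℂ} (hU : IsOpen U) {f : ℂ → ℝ} (hf : IsOpenMap f) {z : ℂ}
    (hz : z ∈ closure U) (hmax : ∀ w ∈ closure U, f w ≤ f z) : z ∈ frontier U := by
  rw [hU.frontier_eq]
  refine ⟨hz, fun hzU => ?_⟩
  obtain ⟨δ, hδ, hball⟩ := Metric.isOpen_iff.1 (hf U hU) (f z) (mem_image_of_mem f hzU)
  obtain ⟨w, hw, hwz⟩ := hball (show f z + δ / 2 ∈ Metric.ball (f z) δ by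
    rw [Metric.mem_ball, Real.dist_eq, add_sub_cancel_left, abs_of_pos (half_pos hδ)]
    exact half_lt_self hδ)
  linarith [hmax w (subset_closure hw)]

/-- If the points of the boundary of `U` where `f` is largest lie in `K`, and `f ≤ b` on `K`, then
`U` only reaches the level `b` within `K`. -/
theorem closure_le_of_extremal {U K : Set ℂ} (hU : IsOpen U) (hb : Bornology.IsBounded U)
    {f : ℂ → ℝ} (hfc : Continuous f) (hf : IsOpenMap f)
    (hext : ∀ z ∈ frontier U, (∀ w ∈ frontier U, f w ≤ f z) → z ∈ K) {b : ℝ}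
    (hK : ∀ z ∈ K, f z ≤ b) {z : ℂ} (hz : z ∈ closure U) (hbz : b ≤ f z) : z ∈ K := by
  have key : ∀ w ∈ closure U, (∀ v ∈ closure U, f v ≤ f w) → w ∈ K := fun w hw hmax =>
    hext w (mem_frontier_of_isMaxOn hU hf hw hmax) fun v hv => hmax v (frontier_subset_closure hv)
  obtain ⟨w, hw, hmax⟩ := hb.isCompact_closure.exists_isMaxOn ⟨z, hz⟩ hfc.continuousOn
  have hmax' : ∀ v ∈ closure U, f v ≤ f w := hmax
  -- The maximum of `f` on the closure is attained in `K`, hence is at most `b`. So a point at level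
  -- at least `b` is itself a maximum and lies in `K`.
  exact key z hz fun v hv => (hmax' v hv).trans ((hK w (key w hw hmax')).trans hbz)

namespace Data

variable (P : Data)

/-- The left end of the gap between `Q_{k+1}` and `Q_k`. -/
def lo (k : ℕ) : ℝ := P.a (k + 1) + P.R (k + 1)

/-- The right end of the gap between `Q_{k+1}` and `Q_k`. -/
def hi (k : ℕ) : ℝ := P.a k - P.R k

/-- The abscissa of the centres of the column `q^e_{n,m,ℓ}`. -/
noncomputable def colE (n m : ℕ) : ℝ := P.a n + (1 - P.s m) * P.T n (m - 1) - P.R n * P.d m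

/-- The abscissa of the centres of the column `q^w_{k,m,ℓ}`. -/
noncomputable def colW (k m : ℕ) : ℝ := P.colE (k + 1) m + P.t k m

/-- The relative height of the centres of `q^e_{n,m,ℓ}` and `q^w_{k,m,ℓ}`. -/
noncomputable def relHeight (m ℓ : ℕ) : ℝ := ((ℓ : ℝ) - 1) * (P.s m + P.d m) + P.d m / 2

/-- The height in the gap between `Q_{k+1}` and `Q_k` that corresponds to the relative height
`t`. -/
def height (k : ℕ) (t : ℝ) : ℝ := -P.R (k + 1) + 2 * P.R (k + 1) * t

theorem hi_eq (k : ℕ) : P.hi k = P.lo k + P.gap k := by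
  simp only [hi, lo, gap]; ring

theorem mem_q {m ℓ : ℕ} {z : ℂ} : z ∈ P.q m ℓ ↔
    |z.re - P.relHeight m ℓ| ≤ P.d m / 2 ∧ |z.im - P.d m / 2| ≤ P.d m / 2 := by
  simp only [q, Complex.mem_reProdIm, mem_Icc, abs_le, relHeight]
  constructor <;> rintro ⟨⟨h1, h2⟩, h3, h4⟩ <;> refine ⟨⟨?_, ?_⟩, ?_, ?_⟩ <;> linarith

theorem φ_re (n m : ℕ) (z : ℂ) :
    (P.φ n m z).re = P.a n + (1 - P.s m) * P.T n (m - 1) - 2 * P.R n * z.im := by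
  simp only [φ, φ₀, φ₁, Complex.add_re, Complex.mul_re, Complex.sub_re, Complex.sub_im]
  ring

theorem φ_im (n m : ℕ) (z : ℂ) : (P.φ n m z).im = -P.R n + 2 * P.R n * z.re := by
  simp only [φ, φ₀, φ₁, Complex.add_im, Complex.mul_im, Complex.sub_re, Complex.sub_im]
  ring

variable {P}

/-- The map `φ` is multiplication by $2R_n i$ plus a translation, so it turns the row of model
squares into a column and exchanges the roles of the two coordinates. The shift `τ` is `0` for the
east squares and `t_{k,m}` for the west ones. -/
theorem mem_homothety_image {n m ℓ : ℕ} {e τ : ℝ} (hR : 0 < P.R n) (he : 0 < 1 + e) {w : ℂ} :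
    w ∈ AffineMap.homothety (P.φ n m (P.qCentre m ℓ) + (τ : ℂ)) (1 + e) ''
      ((fun z => P.φ n m z + (τ : ℂ)) '' P.q m ℓ) ↔
    |w.re - (P.colE n m + τ)| ≤ P.R n * ((1 + e) * P.d m) ∧
      |w.im - (-P.R n + 2 * P.R n * P.relHeight m ℓ)| ≤ P.R n * ((1 + e) * P.d m) := by
  set c : ℝ := 2 * P.R n * (1 + e) with hc
  have hcpos : 0 < c := by positivity
  have hre : ∀ z : ℂ, (AffineMap.homothety (P.φ n m (P.qCentre m ℓ) + (τ : ℂ)) (1 + e)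
      (P.φ n m z + (τ : ℂ))).re - (P.colE n m + τ) = -(c * (z.im - P.d m / 2)) := by
    intro z
    simp only [AffineMap.homothety_apply, vsub_eq_sub, vadd_eq_add, Complex.add_re,
      Complex.real_smul, Complex.sub_re, Complex.mul_re, Complex.ofReal_re, Complex.ofReal_im,
      φ_re, qCentre, colE, hc]
    simp
    ring
  have him : ∀ z : ℂ, (AffineMap.homothety (P.φ n m (P.qCentre m ℓ) + (τ : ℂ)) (1 + e)
      (P.φ n m z + (τ : ℂ))).im - (-P.R n + 2 * P.R n * P.relHeight m ℓ)
      = c * (z.re - P.relHeight m ℓ) := by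
    intro z
    simp only [AffineMap.homothety_apply, vsub_eq_sub, vadd_eq_add, Complex.add_im,
      Complex.real_smul, Complex.sub_im, Complex.mul_im, Complex.ofReal_re, Complex.ofReal_im,
      φ_im, qCentre, relHeight, hc]
    simp
    ring
  have hcd : P.R n * ((1 + e) * P.d m) = c * (P.d m / 2) := by rw [hc]; ring
  have hiff : ∀ x : ℝ, |c * x| ≤ c * (P.d m / 2) ↔ |x| ≤ P.d m / 2 := fun x => by
    rw [abs_mul, abs_of_pos hcpos, mul_le_mul_iff_right₀ hcpos]
  rw [hcd]
  constructor
  · rintro ⟨_, ⟨z, hz, rfl⟩, rfl⟩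
    rw [hre, him, abs_neg, hiff, hiff]
    exact (P.mem_q.1 hz).symm
  · rintro ⟨h1, h2⟩
    set z : ℂ := ⟨P.relHeight m ℓ + (w.im - (-P.R n + 2 * P.R n * P.relHeight m ℓ)) / c,
      P.d m / 2 - (w.re - (P.colE n m + τ)) / c⟩ with hz
    have hw : AffineMap.homothety (P.φ n m (P.qCentre m ℓ) + (τ : ℂ)) (1 + e : ℝ)
        (P.φ n m z + (τ : ℂ)) = w := by
      have e1 := hre z
      have e2 := him z
      simp only [hz] at e1 e2
      apply Complex.ext
      · have : -(c * (P.d m / 2 - (w.re - (P.colE n m + τ)) / c - P.d m / 2))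
            = w.re - (P.colE n m + τ) := by field_simp; ring
        rw [this] at e1
        exact sub_left_injective e1
      · have : c * (P.relHeight m ℓ + (w.im - (-P.R n + 2 * P.R n * P.relHeight m ℓ)) / c
            - P.relHeight m ℓ) = w.im - (-P.R n + 2 * P.R n * P.relHeight m ℓ) := by
          field_simp; ring
        rw [this] at e2
        exact sub_left_injective e2
    refine ⟨_, ⟨z, ?_, rfl⟩, hw⟩
    have e1 := hre z
    have e2 := him z
    rw [hw] at e1 e2
    rw [e1, abs_neg, hiff] at h1
    rw [e2, hiff] at h2
    exact P.mem_q.2 ⟨h2, h1⟩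

theorem mem_qeInfl {n m ℓ j : ℕ} (hR : 0 < P.R n) (he : 0 < 1 + P.ε j) {w : ℂ} :
    w ∈ P.qeInfl n m ℓ j ↔
      |w.re - P.colE n m| ≤ P.R n * ((1 + P.ε j) * P.d m) ∧
      |w.im - (-P.R n + 2 * P.R n * P.relHeight m ℓ)| ≤ P.R n * ((1 + P.ε j) * P.d m) := by
  have := mem_homothety_image (P := P) (m := m) (ℓ := ℓ) (τ := 0) hR he (w := w)
  simpa only [qeInfl, qe, Complex.ofReal_zero, add_zero] using this

theorem mem_qwInfl {k m ℓ j : ℕ} (hR : 0 < P.R (k + 1)) (he : 0 < 1 + P.ε j) {w : ℂ} :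
    w ∈ P.qwInfl k m ℓ j ↔
      |w.re - P.colW k m| ≤ P.R (k + 1) * ((1 + P.ε j) * P.d m) ∧
      |w.im - P.height k (P.relHeight m ℓ)| ≤ P.R (k + 1) * ((1 + P.ε j) * P.d m) :=
  mem_homothety_image hR he

/-! ### Numerical consequences of the requirements -/

namespace IsConstruction

variable (hP : P.IsConstruction)
include hP

theorem R_succ_pos (k : ℕ) : 0 < P.R (k + 1) := hP.R_pos _ (by omega)

theorem R_succ_le {k : ℕ} (hk : 1 ≤ k) : P.R (k + 1) ≤ P.R k :=
  hP.R_anti (mem_Ici.2 hk) (mem_Ici.2 (by omega)) (by omega)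

theorem gap_pos {k : ℕ} (hk : 1 ≤ k) : 0 < P.gap k := by
  rw [hP.gap_eq k hk]
  have := hP.R_succ_pos k
  positivity

theorem gap_le {k : ℕ} (hk : 1 ≤ k) : P.gap k ≤ P.R (k + 1) / 2 := by
  rw [hP.gap_eq k hk]
  have h1 : ((1 : ℝ) / 2) ^ k ≤ (1 / 2) ^ 1 :=
    pow_le_pow_of_le_one (by norm_num) (by norm_num) hk
  have := mul_le_mul_of_nonneg_right h1 (hP.R_succ_pos k).le
  linarith

theorem gap_succ_le {k : ℕ} (hk : 1 ≤ k) : P.gap (k + 1) ≤ P.gap k := by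
  rw [hP.gap_eq k hk, hP.gap_eq (k + 1) (by omega)]
  have h1 : ((1 : ℝ) / 2) ^ (k + 1) ≤ (1 / 2) ^ k :=
    pow_le_pow_of_le_one (by norm_num) (by norm_num) (by omega)
  exact mul_le_mul h1 (hP.R_succ_le (by omega)) (hP.R_succ_pos _).le (by positivity)

theorem R_lt_T {k : ℕ} (hk : 1 ≤ k) (i : ℕ) : P.R k < P.T k i := by
  have := hP.gap_pos hk
  rw [T]
  linarith [mul_pos (pow_pos (show (0 : ℝ) < 1 / 2 by norm_num) (i + 1)) this]

theorem T_anti {k : ℕ} (hk : 1 ≤ k) {i i' : ℕ} (h : i ≤ i') : P.T k i' ≤ P.T k i := by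
  have h1 : ((1 : ℝ) / 2) ^ (i' + 1) ≤ (1 / 2) ^ (i + 1) :=
    pow_le_pow_of_le_one (by norm_num) (by norm_num) (by omega)
  have := mul_le_mul_of_nonneg_right h1 (hP.gap_pos hk).le
  rw [T, T]; linarith

theorem T_le {k : ℕ} (hk : 1 ≤ k) (i : ℕ) : P.T k i ≤ P.R k + P.gap k / 2 := by
  have := hP.T_anti hk (Nat.zero_le i)
  rw [T.eq_1 P k 0] at this
  norm_num at this
  linarith

/-- At `i = 0` there is equality. The strictness leaves room between `Q_{k,i}` and the middle of the
gap on its left. -/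
theorem T_lt_of_pos {k : ℕ} (hk : 1 ≤ k) {i : ℕ} (hi : 1 ≤ i) :
    P.T k i < P.R k + P.gap k / 2 := by
  have := hP.T_anti hk hi
  rw [T.eq_1 P k 1] at this
  norm_num at this
  linarith [hP.gap_pos hk]

theorem lo_lt_hi {k : ℕ} (hk : 1 ≤ k) : P.lo k < P.hi k := by
  rw [hi_eq]; linarith [hP.gap_pos hk]

theorem hi_succ_lt_lo (k : ℕ) : P.hi (k + 1) < P.lo k := by
  have := hP.R_succ_pos k
  rw [hi, lo]; linarith

theorem hi_lt_lo {k k' : ℕ} (hk : 1 ≤ k) (h : k < k') : P.hi k' < P.lo k := by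
  induction k', h using Nat.le_induction with
  | base => exact hP.hi_succ_lt_lo k
  | succ i hi ih =>
    exact (hP.hi_succ_lt_lo i).trans ((hP.lo_lt_hi (by omega)).trans ih)

theorem gap_index_unique {k k' : ℕ} (hk : 1 ≤ k) (hk' : 1 ≤ k') {x : ℝ}
    (h : x ∈ Icc (P.lo k) (P.hi k)) (h' : x ∈ Icc (P.lo k') (P.hi k')) : k = k' := by
  rcases lt_trichotomy k k' with hlt | heq | hlt
  · exact absurd (hP.hi_lt_lo hk hlt) (not_lt.2 (h.1.trans h'.2))
  · exact heq
  · exact absurd (hP.hi_lt_lo hk' hlt) (not_lt.2 (h'.1.trans h.2))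

theorem ε_nonneg {j : ℕ} (hj : 1 ≤ j) : 0 ≤ P.ε j := by
  refine le_of_tendsto hP.ε_lim ?_
  filter_upwards [eventually_ge_atTop j] with i hi
  exact hP.ε_anti.antitoneOn (mem_Ici.2 hj) (mem_Ici.2 (hj.trans hi)) hi

theorem one_add_ε_pos {j : ℕ} (hj : 1 ≤ j) : 0 < 1 + P.ε j := by
  linarith [hP.ε_nonneg hj]

theorem four_le_M {m : ℕ} (hm : 1 ≤ m) : 4 ≤ P.M m := by
  refine le_trans ?_ (hP.M_large m hm)
  have : 2 ^ 2 ≤ 2 ^ (m + 1) := Nat.pow_le_pow_right (by norm_num) (by omega)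
  nlinarith

theorem M_mul_d_le {m : ℕ} (hm : 1 ≤ m) : P.M m * P.d m ≤ 1 := by
  have h4 : (4 : ℝ) ≤ P.M m := by exact_mod_cast hP.four_le_M hm
  have := mul_nonneg (show (0 : ℝ) ≤ P.M m - 1 by linarith) (hP.s_pos m hm).le
  linarith [hP.total m hm]

theorem half_le_M_mul_d {m : ℕ} (hm : 1 ≤ m) : 1 / 2 ≤ P.M m * P.d m := by
  have h4 : (4 : ℝ) ≤ P.M m := by exact_mod_cast hP.four_le_M hm
  have := mul_le_mul_of_nonneg_left (hP.s_le_d m hm) (show (0 : ℝ) ≤ P.M m - 1 by linarith)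
  linarith [hP.total m hm, hP.d_pos m hm]

theorem d_le {m : ℕ} (hm : 1 ≤ m) : P.d m ≤ 1 / 4 := by
  have h4 : (4 : ℝ) ≤ P.M m := by exact_mod_cast hP.four_le_M hm
  have := mul_le_mul_of_nonneg_right h4 (hP.d_pos m hm).le
  linarith [hP.M_mul_d_le hm]

/-- This is what the lower bound on $M_m$ is for: generation $m$ has $m$ columns on each side, and
their squared weights then sum over $m$. -/
theorem mul_d_le {m : ℕ} (hm : 1 ≤ m) : m * P.d m ≤ (1 / 2) ^ (m + 1) := by
  have h : (m * 2 ^ (m + 1) : ℝ) ≤ P.M m := by exact_mod_cast hP.M_large m hm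
  have := (mul_le_mul_of_nonneg_right h (hP.d_pos m hm).le).trans (hP.M_mul_d_le hm)
  rw [div_pow, one_pow, le_div_iff₀ (by positivity)]
  linarith

theorem relHeight_mem {m ℓ : ℕ} (hm : 1 ≤ m) (hℓ : 1 ≤ ℓ) (hℓ' : ℓ ≤ P.M m) :
    P.d m / 2 ≤ P.relHeight m ℓ ∧ P.relHeight m ℓ ≤ 1 - P.d m / 2 := by
  have hs := hP.s_pos m hm
  have hd := hP.d_pos m hm
  have h1 : (1 : ℝ) ≤ ℓ := by exact_mod_cast hℓ
  have h2 : (ℓ : ℝ) ≤ P.M m := by exact_mod_cast hℓ'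
  have := hP.total m hm
  rw [relHeight]
  constructor
  · nlinarith
  · have := mul_le_mul_of_nonneg_right (sub_le_sub_right h2 1) (add_pos hs hd).le
    linarith

theorem abs_height_le (k : ℕ) {t : ℝ} (ht : t ∈ Icc (0 : ℝ) 1) :
    |P.height k t| ≤ P.R (k + 1) := by
  have := hP.R_succ_pos k
  rw [height, abs_le]
  constructor <;> nlinarith [ht.1, ht.2]

theorem abs_height_relHeight_le (k : ℕ) {m ℓ : ℕ} (hm : 1 ≤ m) (hℓ : 1 ≤ ℓ) (hℓ' : ℓ ≤ P.M m) :
    |P.height k (P.relHeight m ℓ)| ≤ P.R (k + 1) := by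
  have h := hP.relHeight_mem hm hℓ hℓ'
  have hd := hP.d_pos m hm
  exact hP.abs_height_le k ⟨by linarith, by linarith⟩

/-- Neighbouring squares of a column have centres $2R(s_j+d_j)\le 4Rd_j$ apart and must stay
disjoint after inflation, so inflation cannot more than double the sidelength. -/
theorem one_add_ε_le {j : ℕ} (hj : 1 ≤ j) : 1 + P.ε j ≤ 2 := by
  by_contra! hlt
  have hd := hP.d_pos j hj
  have h4 := hP.four_le_M hj
  have hR := hP.R_succ_pos 1
  have he := hP.one_add_ε_pos hj
  have hlab : ∀ ℓ, 1 ≤ ℓ → ℓ ≤ 4 → Label.west 1 j ℓ ∈ P.smallLabels j j := fun ℓ h1 h2 =>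
    Or.inr ⟨1, j, ℓ, rfl, le_rfl, hj, hj, le_rfl, h1, h2.trans h4⟩
  have hdis := hP.small_disjoint j hj (hlab 1 (by norm_num) (by norm_num))
    (hlab 2 (by norm_num) (by norm_num)) (by simp)
  have hbig : P.s j + P.d j ≤ (1 + P.ε j) * P.d j := by
    nlinarith [hP.s_le_d j hj]
  have hs := hP.s_pos j hj
  have hr : 0 ≤ P.R 2 * ((1 + P.ε j) * P.d j) := by positivity
  have hbig' := mul_le_mul_of_nonneg_left hbig hR.le
  have hsd : 0 ≤ P.R 2 * (P.s j + P.d j) := by positivity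
  -- The midpoint between the centres of the first two squares of the column would lie in both.
  refine hdis.notMem_of_mem_left (a := (⟨P.colW 1 j,
    P.height 1 (P.relHeight j 1) + P.R 2 * (P.s j + P.d j)⟩ : ℂ)) ?_ ?_
  · refine (mem_qwInfl hR he).2 ⟨?_, ?_⟩
    · rwa [sub_self, abs_zero]
    · rw [add_sub_cancel_left, abs_of_nonneg hsd]
      exact hbig'
  · refine (mem_qwInfl hR he).2 ⟨?_, ?_⟩
    · rwa [sub_self, abs_zero]
    · have : P.height 1 (P.relHeight j 1) + P.R 2 * (P.s j + P.d j)
          - P.height 1 (P.relHeight j 2) = -(P.R 2 * (P.s j + P.d j)) := by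
        simp only [height, relHeight]; push_cast; ring
      show |P.height 1 (P.relHeight j 1) + P.R 2 * (P.s j + P.d j)
          - P.height 1 (P.relHeight j 2)| ≤ _
      rw [this, abs_neg, abs_of_nonneg hsd]
      exact hbig'

/-! ### The position of the small squares -/

theorem colE_gt {n m : ℕ} (hn : 1 ≤ n) (hm : 1 ≤ m) : P.a n < P.colE n m := by
  have h1 := hP.s_le_d m hm
  have h2 := hP.d_le hm
  have h3 := hP.R_lt_T hn (m - 1)
  have h4 := hP.R_pos n hn
  rw [colE]
  nlinarith [hP.s_pos m hm]

omit hP in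
theorem mem_Q {k i : ℕ} {z : ℂ} : z ∈ P.Q k i ↔
    (P.a k - P.T k i ≤ z.re ∧ z.re ≤ P.a k + P.T k i) ∧ |z.im| ≤ P.T k i := by
  rw [Q, Complex.mem_reProdIm, mem_Icc, mem_Icc, abs_le]

omit hP in
theorem re_of_mem_interior_Q {k i : ℕ} {z : ℂ} (h : z ∈ interior (P.Q k i)) :
    P.a k - P.T k i < z.re ∧ z.re < P.a k + P.T k i := by
  rw [Q, Complex.interior_reProdIm, Complex.mem_reProdIm, interior_Icc] at h
  exact h.1

omit hP in
theorem re_lt_of_mem_interior_Q₀ {i : ℕ} {z : ℂ} (h : z ∈ interior (P.Q₀ i)) :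
    z.re < P.T₀ i := by
  rw [Q₀, Complex.interior_reProdIm, Complex.mem_reProdIm, interior_Icc] at h
  exact h.1.2

omit hP in
theorem T₀_eq (k : ℕ) : P.T₀ k = P.lo k + P.gap k / 2 := rfl

/-- A square of the east column that misses `Q_{n,i}` lies to the right of it. -/
theorem qeInfl_right {k m ℓ j i : ℕ} (hm : 1 ≤ m) (hj : 1 ≤ j) (hℓ : 1 ≤ ℓ)
    (hℓ' : ℓ ≤ P.M m) (hdis : Disjoint (P.qeInfl (k + 1) m ℓ j) (P.Q (k + 1) i)) {z : ℂ}
    (hz : z ∈ P.qeInfl (k + 1) m ℓ j) : P.a (k + 1) + P.T (k + 1) i < z.re := by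
  by_contra! hle
  have hR := hP.R_succ_pos k
  have he := hP.one_add_ε_pos hj
  have hd := hP.d_pos m hm
  have hz' := (mem_qeInfl hR he).1 hz
  have hc := hP.colE_gt (n := k + 1) (by omega) hm
  have hT := hP.R_lt_T (k := k + 1) (by omega) i
  have hh := hP.abs_height_relHeight_le k hm hℓ hℓ'
  rw [height] at hh
  have h0 : 0 ≤ P.R (k + 1) * ((1 + P.ε j) * P.d m) := by positivity
  -- If a point of the square were not to the right of `Q`, then moving it to the height of the
  -- centre of the square, and right to $a_{k+1}$ if necessary, would give a point of both sets: the
  -- centre of the square is to the right of $a_{k+1}$ and its height is at most $R_{k+1}$.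
  refine hdis.notMem_of_mem_left (a := (⟨max z.re (P.a (k + 1)),
    -P.R (k + 1) + 2 * P.R (k + 1) * P.relHeight m ℓ⟩ : ℂ)) ?_ ?_
  · refine (mem_qeInfl hR he).2 ⟨?_, by rwa [sub_self, abs_zero]⟩
    show |max z.re (P.a (k + 1)) - _| ≤ _
    rcases le_total z.re (P.a (k + 1)) with h | h
    · rw [max_eq_right h]
      have := abs_le.1 hz'.1
      rw [abs_le]
      constructor <;> linarith
    · rw [max_eq_left h]
      exact hz'.1
  · refine mem_Q.2 ⟨⟨?_, max_le hle (by linarith)⟩, by linarith⟩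
    exact le_trans (by linarith) (le_max_right z.re (P.a (k + 1)))

/-- The mirror image of `qeInfl_right`. That the column is to the left of the centre of `Q_k` is a
hypothesis here, because `colW_lt` is proved by an induction that uses this lemma. -/
theorem qwInfl_left {k m ℓ j i : ℕ} (hk : 1 ≤ k) (hm : 1 ≤ m) (hj : 1 ≤ j) (hℓ : 1 ≤ ℓ)
    (hℓ' : ℓ ≤ P.M m) (hcol : P.colW k m < P.a k)
    (hdis : Disjoint (P.qwInfl k m ℓ j) (P.Q k i)) {z : ℂ}
    (hz : z ∈ P.qwInfl k m ℓ j) : z.re < P.a k - P.T k i := by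
  by_contra! hle
  have hR := hP.R_succ_pos k
  have he := hP.one_add_ε_pos hj
  have hd := hP.d_pos m hm
  have hz' := (mem_qwInfl hR he).1 hz
  have hT := hP.R_lt_T (k := k) hk i
  have hRk := hP.R_succ_le hk
  have hh := hP.abs_height_relHeight_le k hm hℓ hℓ'
  have h0 : 0 ≤ P.R (k + 1) * ((1 + P.ε j) * P.d m) := by positivity
  refine hdis.notMem_of_mem_left (a := (⟨min z.re (P.a k), P.height k (P.relHeight m ℓ)⟩ : ℂ)) ?_ ?_
  · refine (mem_qwInfl hR he).2 ⟨?_, by rwa [sub_self, abs_zero]⟩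
    show |min z.re (P.a k) - _| ≤ _
    rcases le_total z.re (P.a k) with h | h
    · rw [min_eq_left h]
      exact hz'.1
    · rw [min_eq_right h]
      have := abs_le.1 hz'.1
      rw [abs_le]
      constructor <;> linarith
  · refine mem_Q.2 ⟨⟨le_min hle (by linarith), ?_⟩, by linarith⟩
    exact le_trans (min_le_right z.re (P.a k)) (by linarith)

theorem mem_qwInfl_centre {k m ℓ j : ℕ} (hm : 1 ≤ m) (hj : 1 ≤ j) :
    (⟨P.colW k m, P.height k (P.relHeight m ℓ)⟩ : ℂ) ∈ P.qwInfl k m ℓ j := by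
  have hR := hP.R_succ_pos k
  have he := hP.one_add_ε_pos hj
  have hd := hP.d_pos m hm
  have h0 : 0 ≤ P.R (k + 1) * ((1 + P.ε j) * P.d m) := by positivity
  refine (mem_qwInfl hR he).2 ⟨?_, ?_⟩ <;> rwa [sub_self, abs_zero]

omit hP in
theorem colW_eq (k m : ℕ) : P.colW k m = P.a k - P.T k (m - 1)
    + (P.s m * P.T (k + 1) (m - 1) + P.d m * (1 - P.R (k + 1))) := by
  rw [colW, colE, t]; ring

/-- The west columns lie to the left of the centres of the squares `Q_k`. The translation length
`t_{k,m}` is not scaled with `R_k`, so this needs the position of the columns further to the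
right. -/
theorem colW_lt {k m : ℕ} (hk : 1 ≤ k) (hkm : k ≤ m) : P.colW k m < P.a k := by
  have hm : 1 ≤ m := hk.trans hkm
  have hd := hP.d_pos m hm
  have hd4 := hP.d_le hm
  have hs := hP.s_pos m hm
  have hsd := hP.s_le_d m hm
  have hsT : ∀ i, 1 ≤ i → P.s m * P.T (i + 1) (m - 1) ≤ 5 / 16 * P.R i := by
    intro i hi
    have h1 := hP.T_le (k := i + 1) (by omega) (m - 1)
    have h2 := hP.gap_le (k := i + 1) (by omega)
    have h3 := hP.R_succ_le (k := i + 1) (by omega)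
    have h4 := hP.R_succ_le hi
    have h5 := hP.R_pos i hi
    nlinarith
  induction k, hk using Nat.le_induction with
  | base =>
    -- For $k=1$ the offset is at most $\frac5{16}+\frac14$, which is less than $1=R_1<T_{1,m-1}$.
    have h1 := hsT 1 le_rfl
    have h2 := hP.R_lt_T le_rfl (m - 1)
    have h3 := hP.R_succ_pos 1
    rw [hP.R_one] at h1 h2
    rw [colW_eq]
    nlinarith
  | succ k hk ih =>
    have hleft := hP.qwInfl_left (ℓ := 1) hk hm hm le_rfl (by linarith [hP.four_le_M hm])
      (ih (by omega)) (disjoint_left.2 fun w hw => (hP.qwInfl_sub k m 1 m hk (by omega) le_rfl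
        le_rfl (by linarith [hP.four_le_M hm]) hw).2) (hP.mem_qwInfl_centre hm hm)
    have h0 : P.colW k m < P.a k - P.T k m := hleft
    rw [colW_eq] at h0 ⊢
    have h1 := hP.T_le hk (m - 1)
    have h2 := hP.gap_le hk
    have h3 := hP.R_lt_T hk m
    have h4 := hP.R_lt_T (k := k + 1) (by omega) (m - 1)
    have h5 := hsT (k + 1) (by omega)
    have h6 := hP.R_succ_pos k
    have h7 := hP.R_succ_pos (k + 1)
    have h8 : 0 < P.s m * P.T (k + 1) (m - 1) := by
      have : 0 < P.T (k + 1) (m - 1) := by linarith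
      positivity
    -- The position in gap $k$ gives $d_m(1-R_{k+1})<R_{k+1}/4$. This yields $d_m\le R_{k+1}/2$ if
    -- $R_{k+1}\le\frac12$; otherwise $d_m\le\frac14$ does. The remaining offset is at most
    -- $\frac5{16}R_{k+1}$.
    rcases le_total (P.R (k + 1)) (1 / 2) with h | h
    · nlinarith
    · nlinarith

/-- West squares stay in the right half of their gap and, by `qeInfl_re`, east squares in the left
half. Hence the segments have positive length. -/
theorem qwInfl_re {k m ℓ j : ℕ} (hk : 1 ≤ k) (hkm : k ≤ m) (hmj : m ≤ j) (hℓ : 1 ≤ ℓ)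
    (hℓ' : ℓ ≤ P.M m) {z : ℂ} (hz : z ∈ P.qwInfl k m ℓ j) :
    P.lo k + P.gap k / 2 < z.re ∧ z.re < P.a k - P.T k m := by
  constructor
  · have h1 := (re_of_mem_interior_Q (hP.qwInfl_sub k m ℓ j hk hkm hmj hℓ hℓ' hz).1).1
    have h2 := hP.T_le hk (m - 1)
    have := P.hi_eq k
    rw [hi] at this
    linarith
  · exact hP.qwInfl_left hk (by omega) (by omega) hℓ hℓ' (hP.colW_lt hk hkm)
      (disjoint_left.2 fun w hw => (hP.qwInfl_sub k m ℓ j hk hkm hmj hℓ hℓ' hw).2) hz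

theorem qeInfl_re {k m ℓ j : ℕ} (hk : 1 ≤ k) (hkm : k ≤ m) (hkj : k + 1 ≤ j) (hmj : m ≤ j)
    (hℓ : 1 ≤ ℓ) (hℓ' : ℓ ≤ P.M m) {z : ℂ} (hz : z ∈ P.qeInfl (k + 1) m ℓ j) :
    P.a (k + 1) + P.T (k + 1) j < z.re ∧ z.re < P.lo k + P.gap k / 2 := by
  constructor
  · refine hP.qeInfl_right (by omega) (by omega) hℓ hℓ' ?_ hz
    -- For `m < j` both sets are members of the family of stage `j`. For `m = j` the east square is
    -- not a member, but then `k + 1 ≤ m` and the inclusion requirement gives disjointness.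
    rcases hmj.lt_or_eq with h | rfl
    · have hE : Label.east (k + 1) m ℓ ∈ P.labels j := Or.inr (Or.inr (Or.inl (Or.inl
        ⟨k + 1, m, ℓ, rfl, by omega, hkj, by omega, by omega, hℓ, hℓ'⟩)))
      have hC : Label.core (k + 1) ∈ P.labels j := Or.inr (Or.inl ⟨k + 1, rfl, by omega, hkj⟩)
      exact hP.pieces_disjoint j (by omega) hE hC (by simp)
    · exact disjoint_left.2 fun w hw =>
        (hP.qeInfl_sub (k + 1) m ℓ m (by omega) hkj le_rfl hℓ hℓ' hw).2
  -- The east column of generation `m = k` in gap `k` is only controlled through `Q_{0,k}`, whose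
  -- right side is the middle of the gap.
  · rcases hkm.lt_or_eq with h | rfl
    · have h1 := (re_of_mem_interior_Q (hP.qeInfl_sub (k + 1) m ℓ j (by omega) h hmj hℓ hℓ' hz).1).2
      have h2 := hP.T_le (k := k + 1) (by omega) (m - 1)
      have h3 := hP.gap_succ_le hk
      rw [lo]
      linarith
    · exact re_lt_of_mem_interior_Q₀ (hP.qeInfl_sub_centre k ℓ j hk hkj hℓ hℓ' hz)

/-! ### The horizontal segments -/

end IsConstruction

variable (P)

/-- The starting abscissa of the horizontal segments in the gap between `Q_{k+1}` and `Q_k`. -/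
noncomputable def segStart (j k : ℕ) : ℝ :=
  if k = j then P.T₀ j else P.colE (k + 1) j + P.R (k + 1) * ((1 + P.ε j) * P.d j)

/-- The final abscissa of the horizontal segments in the gap between `Q_{k+1}` and `Q_k`. -/
noncomputable def segEnd (j k : ℕ) : ℝ :=
  if k = 1 then P.a 1 - P.T 1 j else P.colW k j - P.R (k + 1) * ((1 + P.ε j) * P.d j)

/-- The relative heights at which the horizontal segments may meet a piece of stage `j`. -/
def hitSet (j : ℕ) : Label → Set ℝ
  | .centre => univ
  | .core k => if k = 1 then univ else ∅
  | .east _ m ℓ => Metric.closedBall (P.relHeight m ℓ) ((1 + P.ε j) * P.d m / 2)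
  | .west _ m ℓ => Metric.closedBall (P.relHeight m ℓ) ((1 + P.ε j) * P.d m / 2)
  | .chain _ ℓ => Metric.closedBall (P.relHeight j ℓ) ((1 + P.ε j) * P.d j / 2)

variable {P}

namespace IsConstruction

variable (hP : P.IsConstruction)
include hP

theorem mem_qeInfl_segStart {j k ℓ : ℕ} (hkj : k < j) {t : ℝ}
    (ht : t ∈ Metric.closedBall (P.relHeight j ℓ) (P.d j / 2)) :
    (⟨P.segStart j k, P.height k t⟩ : ℂ) ∈ P.qeInfl (k + 1) j ℓ j := by
  have hR := hP.R_succ_pos k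
  have hj : 1 ≤ j := by omega
  have he := hP.one_add_ε_pos hj
  have hd := hP.d_pos j hj
  have h0 : 0 ≤ P.R (k + 1) * ((1 + P.ε j) * P.d j) := by positivity
  refine (mem_qeInfl hR he).2 ⟨?_, ?_⟩
  · rw [segStart, if_neg hkj.ne, add_sub_cancel_left, abs_of_nonneg h0]
  · have : P.height k t - (-P.R (k + 1) + 2 * P.R (k + 1) * P.relHeight j ℓ)
        = P.R (k + 1) * (2 * (t - P.relHeight j ℓ)) := by rw [height]; ring
    rw [this, abs_mul, abs_of_pos hR, abs_mul, abs_two]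
    rw [Metric.mem_closedBall, Real.dist_eq] at ht
    refine mul_le_mul_of_nonneg_left ?_ hR.le
    nlinarith [hP.ε_nonneg hj]

theorem mem_qwInfl_segEnd {j k ℓ : ℕ} (hj : 1 ≤ j) (hk : k ≠ 1) {t : ℝ}
    (ht : t ∈ Metric.closedBall (P.relHeight j ℓ) (P.d j / 2)) :
    (⟨P.segEnd j k, P.height k t⟩ : ℂ) ∈ P.qwInfl k j ℓ j := by
  have hR := hP.R_succ_pos k
  have he := hP.one_add_ε_pos hj
  have hd := hP.d_pos j hj
  have h0 : 0 ≤ P.R (k + 1) * ((1 + P.ε j) * P.d j) := by positivity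
  refine (mem_qwInfl hR he).2 ⟨?_, ?_⟩
  · rw [segEnd, if_neg hk, sub_sub_cancel_left, abs_neg, abs_of_nonneg h0]
  · have : P.height k t - P.height k (P.relHeight j ℓ)
        = P.R (k + 1) * (2 * (t - P.relHeight j ℓ)) := by rw [height, height]; ring
    rw [this, abs_mul, abs_of_pos hR, abs_mul, abs_two]
    rw [Metric.mem_closedBall, Real.dist_eq] at ht
    refine mul_le_mul_of_nonneg_left ?_ hR.le
    nlinarith [hP.ε_nonneg hj]

theorem mem_closedBall_of_height {j k m ℓ : ℕ} {t : ℝ}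
    (h : |P.height k t - (-P.R (k + 1) + 2 * P.R (k + 1) * P.relHeight m ℓ)|
      ≤ P.R (k + 1) * ((1 + P.ε j) * P.d m)) :
    t ∈ Metric.closedBall (P.relHeight m ℓ) ((1 + P.ε j) * P.d m / 2) := by
  have hR := hP.R_succ_pos k
  have : P.height k t - (-P.R (k + 1) + 2 * P.R (k + 1) * P.relHeight m ℓ)
      = P.R (k + 1) * (2 * (t - P.relHeight m ℓ)) := by rw [height]; ring
  rw [this, abs_mul, abs_of_pos hR, abs_mul, abs_two] at h
  have := le_of_mul_le_mul_left h hR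
  rw [Metric.mem_closedBall, Real.dist_eq]
  linarith

theorem one_le_M {j : ℕ} (hj : 1 ≤ j) : 1 ≤ P.M j := by linarith [hP.four_le_M hj]

theorem centre_mem {j : ℕ} (hj : 1 ≤ j) (ℓ : ℕ) :
    P.relHeight j ℓ ∈ Metric.closedBall (P.relHeight j ℓ) (P.d j / 2) :=
  Metric.mem_closedBall_self (half_pos (hP.d_pos j hj)).le

theorem segStart_bounds {j k : ℕ} (hk : 1 ≤ k) (hkj : k ≤ j) :
    P.lo k < P.segStart j k ∧ P.segStart j k ≤ P.lo k + P.gap k / 2 := by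
  rcases hkj.lt_or_eq with h | rfl
  · have := hP.qeInfl_re hk hkj h le_rfl le_rfl (hP.one_le_M (by omega))
      (hP.mem_qeInfl_segStart h (hP.centre_mem (by omega) 1))
    have hT := hP.R_lt_T (k := k + 1) (by omega) j
    refine ⟨?_, this.2.le⟩
    have h1 : P.a (k + 1) + P.T (k + 1) j < P.segStart j k := this.1
    rw [lo]
    linarith
  · rw [segStart, if_pos rfl, T₀_eq]
    exact ⟨by linarith [hP.gap_pos hk], le_rfl⟩

theorem segEnd_bounds {j k : ℕ} (hk : 1 ≤ k) (hkj : k ≤ j) :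
    P.lo k + P.gap k / 2 < P.segEnd j k ∧ P.segEnd j k ≤ P.a k - P.T k j ∧
      (k ≠ 1 → P.segEnd j k < P.a k - P.T k j) := by
  by_cases h : k = 1
  · subst h
    rw [segEnd, if_pos rfl]
    refine ⟨?_, le_rfl, fun h => absurd rfl h⟩
    have := P.hi_eq 1
    rw [hi] at this
    linarith [hP.T_lt_of_pos hk hkj]
  · have := hP.qwInfl_re hk hkj le_rfl le_rfl (hP.one_le_M (by omega))
      (hP.mem_qwInfl_segEnd (by omega) h (hP.centre_mem (by omega) 1))
    exact ⟨this.1, this.2.le, fun _ => this.2⟩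

theorem seg_subset_gap {j k : ℕ} (hk : 1 ≤ k) (hkj : k ≤ j) :
    Icc (P.segStart j k) (P.segEnd j k) ⊆ Icc (P.lo k) (P.hi k) := by
  have h1 := hP.segStart_bounds hk hkj
  have h2 := hP.segEnd_bounds hk hkj
  have h3 := hP.R_lt_T hk j
  refine Icc_subset_Icc h1.1.le ?_
  rw [hi]
  linarith [h2.2.1]

/-- A segment in gap $k$ starts to the right of $Q_{k+1,j}$, beyond the east column, and ends
strictly to the left of $Q_{k,j}$ unless $k=1$. All other cores are separated from it by whole gaps.
-/
theorem core_hit {j k n : ℕ} (hk : 1 ≤ k) (hkj : k ≤ j) (hn : 1 ≤ n) (hnj : n ≤ j) {z : ℂ}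
    (hre : z.re ∈ Icc (P.segStart j k) (P.segEnd j k)) (hz : z ∈ P.Q n j) : n = 1 := by
  by_contra hn1
  have hg := hP.seg_subset_gap hk hkj hre
  obtain ⟨⟨h1, h2⟩, -⟩ := mem_Q.1 hz
  have hT := hP.T_lt_of_pos hn (hk.trans hkj)
  obtain ⟨i, rfl⟩ : ∃ i, n = i + 1 := ⟨n - 1, by omega⟩
  have hi1 : 1 ≤ i := by omega
  have hhi := P.hi_eq (i + 1)
  have hhi' := P.hi_eq i
  have hgs := hP.gap_succ_le hi1
  have hgp := hP.gap_pos hi1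
  have hgp' := hP.gap_pos hn
  rw [hi] at hhi
  have h1' : P.lo (i + 1) ≤ z.re := by linarith
  have h2' : z.re ≤ P.hi i := by
    have : P.lo i = P.a (i + 1) + P.R (i + 1) := rfl
    linarith
  -- the square `Q_n` lies between the gaps `n` and `n - 1`
  rcases le_or_gt k i with h | h
  · rcases h.lt_or_eq with h | rfl
    · exact absurd (hP.hi_lt_lo hk h) (not_lt.2 (hg.1.trans h2'))
    · have := (hP.qeInfl_re hk (by omega) hnj le_rfl le_rfl (hP.one_le_M (by omega))
        (hP.mem_qeInfl_segStart hnj (hP.centre_mem (by omega) 1))).1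
      have h3 : P.a (k + 1) + P.T (k + 1) j < P.segStart j k := this
      linarith [hre.1]
  · rcases (Nat.succ_le_of_lt h).lt_or_eq with h | rfl
    · exact absurd (hP.hi_lt_lo hn h) (not_lt.2 (h1'.trans hg.2))
    · have h4 := (hP.segEnd_bounds hk hkj).2.2 hn1
      linarith [hre.2]

/-- The relative heights at which the segments meet the pieces. -/
theorem mem_hitSet {j k : ℕ} (hk : 1 ≤ k) (hkj : k ≤ j) {i : Label} (hi : i ∈ P.labels j)
    {x t : ℝ} (hx : x ∈ Icc (P.segStart j k) (P.segEnd j k))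
    (hz : (⟨x, P.height k t⟩ : ℂ) ∈ P.piece j i) : t ∈ P.hitSet j i := by
  have hj : 1 ≤ j := hk.trans hkj
  have hg := hP.seg_subset_gap hk hkj hx
  have he := hP.one_add_ε_pos hj
  have hbase : ∀ k m ℓ : ℕ, (⟨x, P.height k t⟩ : ℂ) ∈ P.qwInfl k m ℓ j →
      t ∈ Metric.closedBall (P.relHeight m ℓ) ((1 + P.ε j) * P.d m / 2) := fun k m ℓ hz =>
    hP.mem_closedBall_of_height ((mem_qwInfl (hP.R_succ_pos k) he).1 hz).2
  have hbasE : ∀ k m ℓ : ℕ, (⟨x, P.height k t⟩ : ℂ) ∈ P.qeInfl (k + 1) m ℓ j →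
      t ∈ Metric.closedBall (P.relHeight m ℓ) ((1 + P.ε j) * P.d m / 2) := fun k m ℓ hz =>
    hP.mem_closedBall_of_height ((mem_qeInfl (hP.R_succ_pos k) he).1 hz).2
  -- Relative heights are scaled differently in different gaps, so the square must first be shown to
  -- lie in the gap of the segment.
  have hwest : ∀ k' m ℓ, 1 ≤ k' → k' ≤ m → m ≤ j → 1 ≤ ℓ → ℓ ≤ P.M m →
      (⟨x, P.height k t⟩ : ℂ) ∈ P.qwInfl k' m ℓ j →
      t ∈ Metric.closedBall (P.relHeight m ℓ) ((1 + P.ε j) * P.d m / 2) := by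
    intro k' m ℓ hk' hkm hmj hℓ hℓ' hz
    have h1 := hP.qwInfl_re hk' hkm hmj hℓ hℓ' hz
    have h2 := hP.gap_pos hk'
    have h3 := hP.R_lt_T hk' m
    obtain rfl : k = k' := by
      refine hP.gap_index_unique hk hk' hg ⟨?_, ?_⟩
      · linarith [h1.1]
      · rw [Data.hi]; linarith [h1.2]
    exact hbase k m ℓ hz
  rcases hi with rfl | ⟨n, rfl, hn, hnj⟩ | (⟨n, m, ℓ, rfl, hn, hnj, hnm, hmj, hℓ, hℓ'⟩ |
    ⟨k', m, ℓ, rfl, hk', hk'j, hkm, hmj, hℓ, hℓ'⟩) | ⟨k', ℓ, rfl, hk', hk'j, hℓ, hℓ'⟩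
  · exact mem_univ t
  · obtain rfl := hP.core_hit hk hkj hn hnj hx hz
    rw [hitSet, if_pos rfl]
    exact mem_univ t
  · obtain ⟨k', rfl⟩ : ∃ k', n = k' + 1 := ⟨n - 1, by omega⟩
    have hz' : (⟨x, P.height k t⟩ : ℂ) ∈ P.qeInfl (k' + 1) m ℓ j := hz
    have h1 := hP.qeInfl_re (by omega) (by omega) hnj (by omega) hℓ hℓ' hz'
    have h2 := hP.gap_pos (k := k') (by omega)
    have h3 := hP.R_lt_T (k := k' + 1) (by omega) j
    have h4 := P.hi_eq k'
    obtain rfl : k = k' := by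
      refine hP.gap_index_unique hk (by omega) hg ⟨?_, ?_⟩
      · rw [lo]; linarith [h1.1]
      · linarith [h1.2]
    exact hbasE k m ℓ hz'
  · exact hwest k' m ℓ hk' hkm (by omega) hℓ hℓ' hz
  · show t ∈ Metric.closedBall (P.relHeight j ℓ) ((1 + P.ε j) * P.d j / 2)
    by_cases hk'1 : k' = 1
    · subst hk'1
      have hz' : (⟨x, P.height k t⟩ : ℂ) ∈ P.Ubar 1 j ℓ := hz
      rw [Ubar, if_pos rfl] at hz'
      exact hwest 1 j ℓ le_rfl hj le_rfl hℓ hℓ' hz'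
    · have hk'2 : 2 ≤ k' := by omega
      have hz' : (⟨x, P.height k t⟩ : ℂ) ∈ P.Ubar k' j ℓ := hz
      rw [Ubar, if_neg hk'1] at hz'
      obtain ⟨hU, -, hUb, -⟩ := hP.U_jordan k' j ℓ hk'2 hk'j hℓ hℓ'
      obtain ⟨n, rfl⟩ : ∃ n, k' = n + 1 := ⟨k' - 1, by omega⟩
      have hQ := re_of_mem_interior_Q (hP.U_sub (n + 1) j ℓ hk'2 hk'j hℓ hℓ' hz').1
      have hQ1 : P.a (n + 1) - P.T (n + 1) (j - 1) < x := hQ.1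
      have hQ2 : x < P.a (n + 1) + P.T (n + 1) (j - 1) := hQ.2
      have hT := hP.T_le hk' (j - 1)
      have hn : 1 ≤ n := by omega
      have h1 := P.hi_eq (n + 1)
      have h2 := P.hi_eq n
      have h3 := hP.gap_succ_le hn
      have h4 := hP.gap_pos hk'
      have h5 : P.lo n = P.a (n + 1) + P.R (n + 1) := rfl
      have h6 : P.hi (n + 1) = P.a (n + 1) - P.R (n + 1) := rfl
      -- The set $\overline U_{n+1,j,\ell}$ lies in $\operatorname{int}Q_{n+1,j-1}$, which reaches
      -- only into the two gaps next to $Q_{n+1}$.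
      have hnk : k = n ∨ k = n + 1 := by
        by_contra! hcon
        rcases lt_or_gt_of_ne hcon.1 with h | h
        · have := hP.hi_lt_lo hk h
          linarith [hg.1]
        · have := hP.hi_lt_lo hk' (show n + 1 < k by omega)
          linarith [hg.2]
      rcases hnk with rfl | rfl
      -- To the right of $Q_{n+1}$ the segment starts at the right side of the east squares. The
      -- rightmost points of $\overline U$ lie in its east square, so any common point with the
      -- segment does too.
      · refine hbasE k j ℓ (closure_le_of_extremal hU hUb Complex.continuous_re
          Complex.isOpenMap_re (hP.U_rightmost _ j ℓ hk'2 hk'j hℓ hℓ') (b := P.segStart j k)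
          (fun w hw => ?_) hz' hx.1)
        have := (abs_le.1 ((mem_qeInfl (hP.R_succ_pos k) he).1 hw).1).2
        rw [segStart, if_neg (by omega)]
        linarith
      -- The same on the left, with the negative real part as the function to be maximized.
      · refine hbase (n + 1) j ℓ (closure_le_of_extremal hU hUb Complex.continuous_re.neg
          ((Homeomorph.neg ℝ).isOpenMap.comp Complex.isOpenMap_re) (fun z hz h =>
            hP.U_leftmost _ j ℓ hk'2 hk'j hℓ hℓ' z hz fun w hw => neg_le_neg_iff.1 (h w hw))
          (b := -P.segEnd j (n + 1)) (fun w hw => ?_) hz' (neg_le_neg hx.2))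
        have := (abs_le.1 ((mem_qwInfl (hP.R_succ_pos (n + 1)) he).1 hw).1).1
        rw [segEnd, if_neg hk'1, Pi.neg_apply]
        linarith

end IsConstruction

end Data

end SquareDomain

/-! ### Young's inequality, Fubini and sums -/

namespace SquareDomain

open Transboundary

/-- The difference of the two sides is $9c\,(x-y/(18c))^2$ for finite $x$. The parameter $c$ is
$2R_{k+1}$ in gap $k$ and $1$ for components, so that $\rho^2$ gets the same factor $9$ everywhere.
-/
theorem ennreal_mul_le_sq (x : ℝ≥0∞) {y c : ℝ} (hc : 0 < c) :
    x * ENNReal.ofReal y ≤ 9 * (ENNReal.ofReal c * x ^ 2) + ENNReal.ofReal (y ^ 2 / (36 * c)) := by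
  by_cases hx : x = ∞
  · have : 9 * (ENNReal.ofReal c * x ^ 2) = ∞ := by
      rw [hx, ENNReal.top_pow two_ne_zero, ENNReal.mul_top (ENNReal.ofReal_pos.2 hc).ne',
        ENNReal.mul_top (by norm_num)]
    rw [this, top_add]
    exact le_top
  · obtain ⟨r, hr, rfl⟩ : ∃ r : ℝ, 0 ≤ r ∧ x = ENNReal.ofReal r :=
      ⟨x.toReal, ENNReal.toReal_nonneg, (ENNReal.ofReal_toReal hx).symm⟩
    have h9 : (9 : ℝ≥0∞) = ENNReal.ofReal 9 := by simp
    rw [h9, ← ENNReal.ofReal_pow hr, ← ENNReal.ofReal_mul hc.le, ← ENNReal.ofReal_mul (by norm_num : (0 : ℝ) ≤ 9),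
      ← ENNReal.ofReal_mul hr, ← ENNReal.ofReal_add (by positivity) (by positivity)]
    refine ENNReal.ofReal_le_ofReal ?_
    have : 9 * (c * r ^ 2) + y ^ 2 / (36 * c) - r * y = 9 * c * (r - y / (18 * c)) ^ 2 := by
      field_simp
      ring
    have h0 : 0 ≤ 9 * c * (r - y / (18 * c)) ^ 2 := by positivity
    linarith

theorem lintegral_complex (H : ℂ → ℝ≥0∞) (hH : Measurable H) :
    ∫⁻ z, H z = ∫⁻ y : ℝ, ∫⁻ x : ℝ, H (hline y x) := by
  rw [← Complex.volume_preserving_equiv_real_prod.symm.lintegral_comp hH, Measure.volume_eq_prod,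
    lintegral_prod_symm' (fun p => H (Complex.measurableEquivRealProd.symm p))
      (hH.comp Complex.measurableEquivRealProd.symm.measurable)]
  rfl

theorem lintegral_comp_affine (g : ℝ → ℝ≥0∞) (hg : Measurable g) {b c : ℝ} (hc : 0 < c) :
    ENNReal.ofReal c * ∫⁻ t, g (b + c * t) = ∫⁻ y, g y := by
  have h1 : ∫⁻ t, g (b + c * t) = ∫⁻ y, g (b + y) ∂(Measure.map (c * ·) volume) :=
    (lintegral_map (hg.comp (measurable_const_add b)) (measurable_const_mul c)).symm
  rw [h1, Real.map_volume_mul_left hc.ne', lintegral_smul_measure,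
    lintegral_add_left_eq_self, smul_eq_mul, ← mul_assoc, ← ENNReal.ofReal_mul hc.le,
    abs_of_pos (inv_pos.2 hc), mul_inv_cancel₀ hc.ne', ENNReal.ofReal_one, one_mul]

/-- The average over the relative heights of the integrals along the segments in one gap. -/
theorem lintegral_segments_le {F : ℂ → ℝ≥0∞} (hF : Measurable F) {α β R κ : ℝ} {S : Set ℝ}
    (hR : 0 < R) (hκ : β - α ≤ κ * R) (hS : volume S ≤ 1) :
    ∫⁻ t in S, ∫⁻ x in Icc α β, F (hline (-R + 2 * R * t) x) ≤
      9 * (∫⁻ z in Complex.re ⁻¹' Icc α β, F z ^ 2) + ENNReal.ofReal (κ / 72) := by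
  set c := 2 * R with hc
  have hc0 : 0 < c := by positivity
  have hmeas : MeasurableSet (Complex.re ⁻¹' Icc α β) :=
    Complex.measurable_re measurableSet_Icc
  set H : ℂ → ℝ≥0∞ := (Complex.re ⁻¹' Icc α β).indicator fun z => F z ^ 2 with hH
  have hHm : Measurable H := (hF.pow_const 2).indicator hmeas
  have hline2 : Measurable fun p : ℝ × ℝ => hline p.1 p.2 :=
    (Complex.measurableEquivRealProd.symm.measurable).comp measurable_swap
  have hHm2 : Measurable fun y : ℝ => ∫⁻ x, H (hline y x) :=
    (hHm.comp hline2).lintegral_prod_right'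
  -- The choice of `c = 2 * R` as Young parameter makes it cancel against the change of variables
  -- from relative to actual height. The remainder is the width of the gap divided by `36 * c`.
  have hinner : ∀ y : ℝ, ∫⁻ x in Icc α β, F (hline y x) ≤
      9 * (ENNReal.ofReal c * ∫⁻ x, H (hline y x)) + ENNReal.ofReal (κ / 72) := by
    intro y
    have hm : Measurable fun x : ℝ => F (hline y x) ^ 2 :=
      (hF.comp (isometry_hline y).continuous.measurable).pow_const 2
    have e1 : ∫⁻ x, H (hline y x) = ∫⁻ x in Icc α β, F (hline y x) ^ 2 := by
      rw [← lintegral_indicator measurableSet_Icc]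
      rfl
    have e2 : ENNReal.ofReal (1 ^ 2 / (36 * c)) * volume (Icc α β) ≤ ENNReal.ofReal (κ / 72) := by
      rw [Real.volume_Icc, ← ENNReal.ofReal_mul (by positivity)]
      refine ENNReal.ofReal_le_ofReal ?_
      rw [hc, one_pow, one_div, inv_mul_le_iff₀ (by positivity)]
      linarith
    calc ∫⁻ x in Icc α β, F (hline y x)
        ≤ ∫⁻ x in Icc α β, (9 * (ENNReal.ofReal c * F (hline y x) ^ 2)
            + ENNReal.ofReal (1 ^ 2 / (36 * c))) := by
          refine lintegral_mono fun x => ?_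
          simpa using ennreal_mul_le_sq (F (hline y x)) (y := 1) hc0
      _ = 9 * (ENNReal.ofReal c * ∫⁻ x, H (hline y x))
            + ENNReal.ofReal (1 ^ 2 / (36 * c)) * volume (Icc α β) := by
          rw [lintegral_add_right _ measurable_const, lintegral_const_mul _ (hm.const_mul _),
            lintegral_const_mul _ hm, setLIntegral_const, e1]
      _ ≤ _ := add_le_add le_rfl e2
  calc ∫⁻ t in S, ∫⁻ x in Icc α β, F (hline (-R + c * t) x)
      ≤ ∫⁻ t in S, (9 * (ENNReal.ofReal c * ∫⁻ x, H (hline (-R + c * t) x))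
          + ENNReal.ofReal (κ / 72)) := lintegral_mono fun t => hinner _
    _ = (∫⁻ t in S, 9 * (ENNReal.ofReal c * ∫⁻ x, H (hline (-R + c * t) x)))
          + ENNReal.ofReal (κ / 72) * volume S := by
        rw [lintegral_add_right _ measurable_const, setLIntegral_const]
    _ ≤ (∫⁻ t, 9 * (ENNReal.ofReal c * ∫⁻ x, H (hline (-R + c * t) x)))
          + ENNReal.ofReal (κ / 72) * 1 :=
        add_le_add (setLIntegral_le_lintegral _ _) (mul_le_mul_right hS _)
    _ = 9 * (∫⁻ z in Complex.re ⁻¹' Icc α β, F z ^ 2) + ENNReal.ofReal (κ / 72) := by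
        have hm : Measurable fun t : ℝ => ∫⁻ x, H (hline (-R + c * t) x) :=
          hHm2.comp (by fun_prop : Measurable fun t : ℝ => -R + c * t)
        rw [lintegral_const_mul _ (hm.const_mul _), lintegral_const_mul _ hm,
          lintegral_comp_affine _ hHm2 hc0, ← lintegral_complex H hHm, hH,
          lintegral_indicator hmeas, mul_one]

theorem sum_union_le_of_nonneg {κ : Type*} [DecidableEq κ] (s t : Finset κ) {f : κ → ℝ}
    (hf : ∀ x, 0 ≤ f x) : ∑ x ∈ s ∪ t, f x ≤ ∑ x ∈ s, f x + ∑ x ∈ t, f x := by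
  rw [← Finset.sum_union_inter]
  exact le_add_of_nonneg_right (Finset.sum_nonneg fun x _ => hf x)

theorem sum_biUnion_le_of_nonneg {ι κ : Type*} [DecidableEq κ] (s : Finset ι) (t : ι → Finset κ)
    {f : κ → ℝ} (hf : ∀ x, 0 ≤ f x) : ∑ x ∈ s.biUnion t, f x ≤ ∑ i ∈ s, ∑ x ∈ t i, f x := by
  classical
  induction s using Finset.induction_on with
  | empty => simp
  | insert i s hi ih =>
    rw [Finset.biUnion_insert, Finset.sum_insert hi]
    exact (sum_union_le_of_nonneg _ _ hf).trans (add_le_add le_rfl ih)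

theorem sum_half_pow_le (n : ℕ) : ∑ m ∈ Finset.Icc 1 n, ((1 : ℝ) / 2) ^ m ≤ 1 := by
  have : ∑ m ∈ Finset.Icc 1 n, ((1 : ℝ) / 2) ^ m = 1 - (1 / 2) ^ n := by
    induction n with
    | zero => simp
    | succ n ih =>
      rw [Finset.sum_Icc_succ_top (by omega), ih]
      ring
  rw [this]
  linarith [pow_nonneg (show (0 : ℝ) ≤ 1 / 2 by norm_num) n]

/-! ### Finitely many labels, their weights and the good heights -/

namespace Data

variable (P : Data)

open Classical in
/-- The labels of stage `j`, as a finite set. -/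
noncomputable def labelFinset (j : ℕ) : Finset Label :=
  {.centre} ∪ (Finset.Icc 1 j).biUnion (fun k => {.core k}) ∪
  (Finset.Icc 1 (j - 1)).biUnion (fun m => (Finset.Icc 2 (m + 1)).biUnion fun n =>
    (Finset.Icc 1 (P.M m)).biUnion fun ℓ => {.east n m ℓ}) ∪
  (Finset.Icc 1 (j - 1)).biUnion (fun m => (Finset.Icc 1 m).biUnion fun k =>
    (Finset.Icc 1 (P.M m)).biUnion fun ℓ => {.west k m ℓ}) ∪
  (Finset.Icc 1 j).biUnion (fun k => (Finset.Icc 1 (P.M j)).biUnion fun ℓ => {.chain k ℓ})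

theorem mem_labelFinset {j : ℕ} {i : Label} : i ∈ P.labelFinset j ↔ i ∈ P.labels j := by
  cases i <;>
    simp only [labelFinset, labels, smallLabels, Finset.mem_union, Finset.mem_biUnion,
      Finset.mem_singleton, Finset.mem_Icc, mem_ofPred_eq, reduceCtorEq, and_false, false_and,
      exists_false, or_false, false_or, Label.core.injEq, Label.east.injEq, Label.west.injEq,
      Label.chain.injEq]
  case core k =>
    constructor
    · rintro ⟨_, h, rfl⟩; exact ⟨_, rfl, h⟩
    · rintro ⟨_, rfl, h⟩; exact ⟨_, h, rfl⟩
  case east n m ℓ =>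
    constructor
    · rintro ⟨_, h1, _, h2, _, h3, rfl, rfl, rfl⟩
      exact ⟨_, _, _, ⟨rfl, rfl, rfl⟩, by omega⟩
    · rintro ⟨_, _, _, ⟨rfl, rfl, rfl⟩, h⟩
      exact ⟨_, by omega, _, by omega, _, by omega, rfl, rfl, rfl⟩
  case west n m ℓ =>
    constructor
    · rintro ⟨_, h1, _, h2, _, h3, rfl, rfl, rfl⟩
      exact ⟨_, _, _, ⟨rfl, rfl, rfl⟩, by omega⟩
    · rintro ⟨_, _, _, ⟨rfl, rfl, rfl⟩, h⟩
      exact ⟨_, by omega, _, by omega, _, by omega, rfl, rfl, rfl⟩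
  case chain k ℓ =>
    constructor
    · rintro ⟨_, h1, _, h2, rfl, rfl⟩
      exact ⟨_, _, ⟨rfl, rfl⟩, by omega⟩
    · rintro ⟨_, _, ⟨rfl, rfl⟩, h⟩
      exact ⟨_, by omega, _, by omega, rfl, rfl⟩

/-- Upper bound for the measure of the set of relative heights at which the segments meet a
piece. -/
noncomputable def weight (j : ℕ) : Label → ℝ
  | .centre => 1
  | .core k => if k = 1 then 1 else 0
  | .east _ m _ => 2 * P.d m
  | .west _ m _ => 2 * P.d m
  | .chain _ _ => 2 * P.d j

/-- The relative heights of the squares of generation `j`. -/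
def goodHeights (j : ℕ) : Set ℝ :=
  ⋃ ℓ ∈ Finset.Icc 1 (P.M j), Metric.closedBall (P.relHeight j ℓ) (P.d j / 2)

theorem measurableSet_goodHeights (j : ℕ) : MeasurableSet (P.goodHeights j) :=
  Finset.measurableSet_biUnion _ fun _ _ => measurableSet_closedBall

theorem coe_mem_Dom_iff {j : ℕ} {z : ℂ} :
    (z : Sphere) ∈ P.Dom j ↔ ∀ i ∈ P.labels j, z ∉ P.piece j i := by
  simp only [Dom, onSphere, mem_compl_iff, mem_image, mem_iUnion, OnePoint.coe_eq_coe,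
    exists_eq_right, not_exists, exists_prop, not_and]

theorem coe_notMem_Dom_iff {j : ℕ} {z : ℂ} :
    (z : Sphere) ∉ P.Dom j ↔ ∃ i ∈ P.labels j, z ∈ P.piece j i := by
  rw [coe_mem_Dom_iff]
  push Not
  rfl

theorem measurableSet_hitSet (j : ℕ) (i : Label) : MeasurableSet (P.hitSet j i) := by
  cases i <;> simp only [hitSet]
  · exact MeasurableSet.univ
  · split_ifs
    · exact MeasurableSet.univ
    · exact MeasurableSet.empty
  all_goals exact measurableSet_closedBall

theorem isCompact_rect (a b c d : ℝ) : IsCompact (Icc a b ×ℂ Icc c d) :=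
  isCompact_Icc.reProdIm isCompact_Icc

theorem isPreconnected_rect (a b c d : ℝ) : IsPreconnected (Icc a b ×ℂ Icc c d) :=
  (((convex_Icc a b).linear_preimage Complex.reLm).inter
    ((convex_Icc c d).linear_preimage Complex.imLm)).isPreconnected

theorem continuous_φ (n m : ℕ) : Continuous (P.φ n m) := by
  unfold φ; fun_prop

theorem continuous_homothety (c : ℂ) (r : ℝ) : Continuous (AffineMap.homothety c r : ℂ → ℂ) := by
  simp only [AffineMap.coe_homothety]
  fun_prop

variable {P}

namespace IsConstruction

variable (hP : P.IsConstruction)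
include hP

/-- Consecutive centres are $s_j+d_j>d_j$ apart, so the $M_j$ intervals of length $d_j$ are disjoint
and their total length is $M_jd_j\ge\frac12$. -/
theorem volume_goodHeights_ge {j : ℕ} (hj : 1 ≤ j) :
    ENNReal.ofReal (1 / 2) ≤ volume (P.goodHeights j) := by
  have hd := hP.d_pos j hj
  have hs := hP.s_pos j hj
  have hlt : ∀ ℓ ℓ' : ℕ, ℓ < ℓ' → Disjoint (Metric.closedBall (P.relHeight j ℓ) (P.d j / 2))
      (Metric.closedBall (P.relHeight j ℓ') (P.d j / 2)) := by
    intro ℓ ℓ' h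
    refine Metric.closedBall_disjoint_closedBall ?_
    have h' : (ℓ : ℝ) + 1 ≤ ℓ' := by exact_mod_cast h
    rw [dist_comm, Real.dist_eq, relHeight, relHeight]
    refine lt_of_lt_of_le ?_ (le_abs_self _)
    nlinarith
  rw [goodHeights, measure_biUnion_finset]
  · simp only [Real.volume_closedBall, Finset.sum_const, Nat.card_Icc, add_tsub_cancel_right]
    rw [← ENNReal.ofReal_nsmul]
    refine ENNReal.ofReal_le_ofReal ?_
    rw [nsmul_eq_mul]
    linarith [hP.half_le_M_mul_d hj]
  · intro ℓ _ ℓ' _ hne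
    rcases lt_or_gt_of_ne hne with h | h
    · exact hlt _ _ h
    · exact (hlt _ _ h).symm
  · exact fun _ _ => measurableSet_closedBall

theorem goodHeights_subset {j : ℕ} (hj : 1 ≤ j) : P.goodHeights j ⊆ Icc 0 1 := by
  intro t ht
  obtain ⟨ℓ, hℓ, ht⟩ := mem_iUnion₂.1 ht
  rw [Finset.mem_Icc] at hℓ
  have := hP.relHeight_mem hj hℓ.1 hℓ.2
  rw [Metric.mem_closedBall, Real.dist_eq, abs_le] at ht
  constructor <;> linarith

theorem volume_goodHeights_le {j : ℕ} (hj : 1 ≤ j) : volume (P.goodHeights j) ≤ 1 :=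
  (measure_mono (hP.goodHeights_subset hj)).trans (by simp)

theorem volume_hit_le {j : ℕ} {i : Label} (hj : 1 ≤ j) (hi : i ∈ P.labels j) :
    volume (P.hitSet j i ∩ P.goodHeights j) ≤ ENNReal.ofReal (P.weight j i) := by
  have h1 : volume (P.hitSet j i ∩ P.goodHeights j) ≤ 1 :=
    (measure_mono inter_subset_right).trans (hP.volume_goodHeights_le hj)
  have hball : ∀ (c : ℝ) (m : ℕ), 1 ≤ m →
      volume (Metric.closedBall c ((1 + P.ε j) * P.d m / 2)) ≤ ENNReal.ofReal (2 * P.d m) := by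
    intro c m hm
    rw [Real.volume_closedBall]
    refine ENNReal.ofReal_le_ofReal ?_
    have := mul_le_mul_of_nonneg_right (hP.one_add_ε_le hj) (hP.d_pos m hm).le
    linarith
  rcases hi with rfl | ⟨k, rfl, -⟩ | (⟨n, m, ℓ, rfl, hn, -, hnm, -⟩ |
    ⟨n, m, ℓ, rfl, hn, -, hnm, -⟩) | ⟨k, ℓ, rfl, -⟩
  · simpa only [weight, ENNReal.ofReal_one] using h1
  · by_cases hk : k = 1
    · simpa only [weight, if_pos hk, ENNReal.ofReal_one] using h1
    · simp [hitSet, hk]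
  · exact (measure_mono inter_subset_left).trans (hball _ m (by omega))
  · exact (measure_mono inter_subset_left).trans (hball _ m (by omega))
  · exact (measure_mono inter_subset_left).trans (hball _ j hj)

/-- The bound is $1+1+2+2+1$, for $Q_0$, the cores (only $Q_1$ counts), the east squares, the west
squares and the sets $\overline U$. Each column of generation $m$ gives $M_m(2d_m)^2\le4d_m$, and
there are $m$ columns on each side. -/
theorem sum_weight_sq_le {j : ℕ} (hj : 1 ≤ j) :
    ∑ i ∈ P.labelFinset j, P.weight j i ^ 2 ≤ 7 := by
  classical
  have hf : ∀ i, 0 ≤ P.weight j i ^ 2 := fun i => sq_nonneg _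
  have hcol : ∀ m, 1 ≤ m → (P.M m : ℝ) * (2 * P.d m) ^ 2 ≤ 4 * P.d m := by
    intro m hm
    have := mul_le_mul_of_nonneg_right (hP.M_mul_d_le hm)
      (show 0 ≤ 4 * P.d m by linarith [hP.d_pos m hm])
    linarith
  have hcore : ∑ x ∈ (Finset.Icc 1 j).biUnion (fun k => ({.core k} : Finset Label)),
      P.weight j x ^ 2 ≤ 1 := by
    refine (sum_biUnion_le_of_nonneg _ _ hf).trans ?_
    simp only [Finset.sum_singleton, weight, ite_pow, one_pow, zero_pow two_ne_zero]
    rw [Finset.sum_ite_eq']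
    split_ifs <;> norm_num
  have hsmall : ∀ s : ℕ → Finset ℕ, (∀ m, (s m).card = m) →
      ∑ m ∈ Finset.Icc 1 (j - 1), ∑ _n ∈ s m, ∑ _ℓ ∈ Finset.Icc 1 (P.M m),
        (2 * P.d m) ^ 2 ≤ 2 := by
    intro s hs
    have : ∀ m ∈ Finset.Icc 1 (j - 1), ∑ _n ∈ s m, ∑ _ℓ ∈ Finset.Icc 1 (P.M m),
        (2 * P.d m) ^ 2 ≤ 2 * (1 / 2) ^ m := by
      intro m hm
      have hm1 := (Finset.mem_Icc.1 hm).1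
      simp only [Finset.sum_const, hs, Nat.card_Icc, add_tsub_cancel_right, nsmul_eq_mul]
      have h1 := mul_le_mul_of_nonneg_left (hcol m hm1) (Nat.cast_nonneg (α := ℝ) m)
      have h2 := hP.mul_d_le hm1
      rw [pow_succ] at h2
      linarith
    refine (Finset.sum_le_sum this).trans ?_
    rw [← Finset.mul_sum]
    linarith [sum_half_pow_le (j - 1)]
  have heast : ∑ x ∈ (Finset.Icc 1 (j - 1)).biUnion (fun m => (Finset.Icc 2 (m + 1)).biUnion
      fun n => (Finset.Icc 1 (P.M m)).biUnion fun ℓ => ({.east n m ℓ} : Finset Label)),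
      P.weight j x ^ 2 ≤ 2 := by
    refine ((sum_biUnion_le_of_nonneg _ _ hf).trans ?_).trans
      (hsmall (fun m => Finset.Icc 2 (m + 1)) fun m => by simp)
    refine Finset.sum_le_sum fun m _ => (sum_biUnion_le_of_nonneg _ _ hf).trans ?_
    refine Finset.sum_le_sum fun n _ => (sum_biUnion_le_of_nonneg _ _ hf).trans ?_
    simp [weight]
  have hwest : ∑ x ∈ (Finset.Icc 1 (j - 1)).biUnion (fun m => (Finset.Icc 1 m).biUnion
      fun n => (Finset.Icc 1 (P.M m)).biUnion fun ℓ => ({.west n m ℓ} : Finset Label)),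
      P.weight j x ^ 2 ≤ 2 := by
    refine ((sum_biUnion_le_of_nonneg _ _ hf).trans ?_).trans
      (hsmall (fun m => Finset.Icc 1 m) fun m => by simp)
    refine Finset.sum_le_sum fun m _ => (sum_biUnion_le_of_nonneg _ _ hf).trans ?_
    refine Finset.sum_le_sum fun n _ => (sum_biUnion_le_of_nonneg _ _ hf).trans ?_
    simp [weight]
  have hchain : ∑ x ∈ (Finset.Icc 1 j).biUnion (fun k => (Finset.Icc 1 (P.M j)).biUnion
      fun ℓ => ({.chain k ℓ} : Finset Label)), P.weight j x ^ 2 ≤ 1 := by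
    refine (sum_biUnion_le_of_nonneg _ _ hf).trans ?_
    refine (Finset.sum_le_sum fun k _ => sum_biUnion_le_of_nonneg _ _ hf).trans ?_
    simp only [Finset.sum_singleton, weight, Finset.sum_const, Nat.card_Icc,
      add_tsub_cancel_right, nsmul_eq_mul]
    have h1 := mul_le_mul_of_nonneg_left (hcol j hj) (Nat.cast_nonneg (α := ℝ) j)
    have h2 := hP.mul_d_le hj
    have h3 : ((1 : ℝ) / 2) ^ (j + 1) ≤ (1 / 2) ^ 2 :=
      pow_le_pow_of_le_one (by norm_num) (by norm_num) (by omega)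
    linarith
  have hcentre : ∑ x ∈ ({.centre} : Finset Label), P.weight j x ^ 2 = 1 := by
    simp [weight]
  rw [labelFinset]
  refine (sum_union_le_of_nonneg _ _ hf).trans ?_
  refine (add_le_add ((sum_union_le_of_nonneg _ _ hf).trans (add_le_add
    ((sum_union_le_of_nonneg _ _ hf).trans (add_le_add
      ((sum_union_le_of_nonneg _ _ hf).trans (add_le_add hcentre.le hcore)) heast)) hwest))
      hchain).trans ?_
  norm_num

/-! ### The complementary components -/

theorem isCompact_piece {j : ℕ} {i : Label} (hi : i ∈ P.labels j) : IsCompact (P.piece j i) := by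
  have hq : ∀ m ℓ, IsCompact (P.q m ℓ) := fun m ℓ => isCompact_rect _ _ _ _
  have hw : ∀ k m ℓ, IsCompact (P.qwInfl k m ℓ j) := fun k m ℓ =>
    ((hq m ℓ).image ((P.continuous_φ _ _).add continuous_const)).image (continuous_homothety _ _)
  rcases hi with rfl | ⟨k, rfl, -⟩ | (⟨n, m, ℓ, rfl, -⟩ | ⟨n, m, ℓ, rfl, -⟩) |
    ⟨k, ℓ, rfl, hk, hkj, hℓ, hℓ'⟩
  · exact isCompact_rect _ _ _ _
  · exact isCompact_rect _ _ _ _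
  · exact ((hq m ℓ).image (P.continuous_φ _ _)).image (continuous_homothety _ _)
  · exact hw _ _ _
  · show IsCompact (P.Ubar k j ℓ)
    rw [Ubar]
    split_ifs with h
    · exact hw _ _ _
    · exact (hP.U_jordan k j ℓ (by omega) hkj hℓ hℓ').2.2.1.isCompact_closure

theorem isPreconnected_piece {j : ℕ} {i : Label} (hi : i ∈ P.labels j) :
    IsPreconnected (P.piece j i) := by
  have hq : ∀ m ℓ, IsPreconnected (P.q m ℓ) := fun m ℓ => isPreconnected_rect _ _ _ _
  have hw : ∀ k m ℓ, IsPreconnected (P.qwInfl k m ℓ j) := fun k m ℓ =>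
    ((hq m ℓ).image _ ((P.continuous_φ _ _).add continuous_const).continuousOn).image _
      (continuous_homothety _ _).continuousOn
  rcases hi with rfl | ⟨k, rfl, -⟩ | (⟨n, m, ℓ, rfl, -⟩ | ⟨n, m, ℓ, rfl, -⟩) |
    ⟨k, ℓ, rfl, hk, hkj, hℓ, hℓ'⟩
  · exact isPreconnected_rect _ _ _ _
  · exact isPreconnected_rect _ _ _ _
  · exact ((hq m ℓ).image _ (P.continuous_φ _ _).continuousOn).image _
      (continuous_homothety _ _).continuousOn
  · exact hw _ _ _
  · show IsPreconnected (P.Ubar k j ℓ)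
    rw [Ubar]
    split_ifs with h
    · exact hw _ _ _
    · exact (hP.U_jordan k j ℓ (by omega) hkj hℓ hℓ').2.1.isPreconnected.closure

theorem T₀_pos (j : ℕ) (hj : 1 ≤ j) : P.R (j + 1) < P.T₀ j := by
  have h1 := hP.gap_pos hj
  have h2 := hP.R_lt_a (j + 1) (by omega)
  have h3 := hP.R_succ_pos j
  rw [T₀_eq, lo]
  linarith

theorem T₀_anti {j₀ j : ℕ} (hj₀ : 1 ≤ j₀) (hj : j₀ ≤ j) : P.T₀ j ≤ P.T₀ j₀ := by
  induction j, hj using Nat.le_induction with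
  | base => exact le_rfl
  | succ i hi ih =>
    refine le_trans ?_ ih
    have h1 := hP.hi_succ_lt_lo i
    have h2 := hP.gap_pos (k := i) (by omega)
    have h3 := hP.gap_pos (k := i + 1) (by omega)
    rw [hi_eq] at h1
    rw [T₀_eq, T₀_eq]
    linarith

omit hP in
theorem mem_Q₀ {j : ℕ} {z : ℂ} : z ∈ P.Q₀ j ↔ |z.re| ≤ P.T₀ j ∧ |z.im| ≤ P.T₀ j := by
  rw [Q₀, Complex.mem_reProdIm, mem_Icc, mem_Icc, abs_le, abs_le]

theorem nonempty_piece {j : ℕ} (hj : 1 ≤ j) {i : Label} (hi : i ∈ P.labels j) :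
    (P.piece j i).Nonempty := by
  have hq : ∀ m ℓ, 1 ≤ m → (P.q m ℓ).Nonempty := fun m ℓ hm =>
    ⟨⟨P.relHeight m ℓ, P.d m / 2⟩, P.mem_q.2 (by
      have := hP.d_pos m hm
      simp only [sub_self, abs_zero]
      constructor <;> linarith)⟩
  rcases hi with rfl | ⟨k, rfl, hk, -⟩ | (⟨n, m, ℓ, rfl, hn, -, hnm, -⟩ |
    ⟨n, m, ℓ, rfl, hn, -, hnm, -⟩) | ⟨k, ℓ, rfl, hk, hkj, hℓ, hℓ'⟩
  · have h1 := hP.T₀_pos j hj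
    have h2 := hP.R_succ_pos j
    refine ⟨0, mem_Q₀.2 ?_⟩
    simp only [Complex.zero_re, Complex.zero_im, abs_zero]
    constructor <;> linarith
  · have h1 := hP.R_lt_T hk j
    have h2 := hP.R_pos k hk
    refine ⟨⟨P.a k, 0⟩, mem_Q.2 ?_⟩
    simp only [abs_zero]
    refine ⟨⟨?_, ?_⟩, ?_⟩ <;> linarith
  · exact ((hq m ℓ (by omega)).image _).image _
  · exact ((hq m ℓ (by omega)).image _).image _
  · show (P.Ubar k j ℓ).Nonempty
    rw [Ubar]
    split_ifs with h
    · exact ((hq j ℓ hj).image _).image _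
    · exact (hP.U_jordan k j ℓ (by omega) hkj hℓ hℓ').2.1.nonempty.closure

theorem measurableSet_Dom (j : ℕ) : MeasurableSet {z : ℂ | (z : Sphere) ∈ P.Dom j} := by
  have : {z : ℂ | (z : Sphere) ∈ P.Dom j} = ⋂ i ∈ P.labelFinset j, (P.piece j i)ᶜ := by
    ext z
    simp only [mem_ofPred_eq, coe_mem_Dom_iff, mem_iInter, mem_compl_iff, mem_labelFinset]
  rw [this]
  exact Finset.measurableSet_biInter _ fun i hi =>
    (hP.isCompact_piece (P.mem_labelFinset.1 hi)).isClosed.measurableSet.compl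

theorem proj_eq_of_mem_piece {j : ℕ} {i : Label} (hi : i ∈ P.labels j) {z w : ℂ}
    (hz : z ∈ P.piece j i) (hw : w ∈ P.piece j i) :
    proj (P.Dom j) (z : Sphere) = proj (P.Dom j) (w : Sphere) := by
  refine proj_eq_of_isPreconnected (S := onSphere (P.piece j i))
    ((hP.isPreconnected_piece hi).image _ OnePoint.continuous_coe.continuousOn) ?_
    ⟨z, hz, rfl⟩ ⟨w, hw, rfl⟩
  rintro _ ⟨v, hv, rfl⟩
  exact P.coe_notMem_Dom_iff.2 ⟨i, hi, hv⟩

/-- One piece and the finite union of the others are disjoint compact sets covering the complement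
of the domain. So different labels give different points of the quotient, and the sum over labels is
bounded by the sum in `mass`. -/
theorem proj_ne_of_mem_piece {j : ℕ} (hj : 1 ≤ j) {i i' : Label} (hi : i ∈ P.labels j)
    (hi' : i' ∈ P.labels j) (hne : i ≠ i') {z w : ℂ}
    (hz : z ∈ P.piece j i) (hw : w ∈ P.piece j i') :
    proj (P.Dom j) (z : Sphere) ≠ proj (P.Dom j) (w : Sphere) := by
  classical
  set L : Set ℂ := ⋃ n ∈ (P.labelFinset j).erase i, P.piece j n with hL
  have hLc : IsCompact L := ((P.labelFinset j).erase i).isCompact_biUnion fun n hn =>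
    hP.isCompact_piece (P.mem_labelFinset.1 (Finset.mem_of_mem_erase hn))
  have hclosed : ∀ K : Set ℂ, IsCompact K → IsClosed (onSphere K) := fun K hK =>
    (hK.image OnePoint.continuous_coe).isClosed
  refine proj_ne_of_closed_separation (hclosed _ (hP.isCompact_piece hi)) (hclosed L hLc) ?_ ?_
    ⟨z, hz, rfl⟩ ⟨w, ?_, rfl⟩
  · refine (disjoint_image_iff OnePoint.coe_injective).2 ?_
    refine disjoint_iUnion₂_right.2 fun n hn => ?_
    exact hP.pieces_disjoint j hj hi (P.mem_labelFinset.1 (Finset.mem_of_mem_erase hn))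
      (Finset.ne_of_mem_erase hn).symm
  · rw [Dom, compl_compl]
    rintro _ ⟨v, hv, rfl⟩
    obtain ⟨n, hn, hv⟩ := mem_iUnion₂.1 hv
    by_cases hni : n = i
    · exact Or.inl ⟨v, hni ▸ hv, rfl⟩
    · exact Or.inr ⟨v, mem_iUnion₂.2 ⟨n, Finset.mem_erase.2 ⟨hni, P.mem_labelFinset.2 hn⟩, hv⟩, rfl⟩
  · exact mem_iUnion₂.2 ⟨i', Finset.mem_erase.2 ⟨hne.symm, P.mem_labelFinset.2 hi'⟩, hw⟩

/-! ### The paths and the length–area argument -/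

/-- The path through the gaps at one relative height. -/
theorem exists_joining_path {j₀ j ℓ : ℕ} (hj₀ : 1 ≤ j₀) (hj : j₀ ≤ j) (hℓ : 1 ≤ ℓ)
    (hℓ' : ℓ ≤ P.M j) {t : ℝ} (ht : t ∈ Metric.closedBall (P.relHeight j ℓ) (P.d j / 2))
    (ht' : t ∈ Icc (0 : ℝ) 1) :
    ∃ γ ∈ joining (onSphere (P.Q₀ j₀)) (onSphere (P.Q 1 j₀)) (P.Dom j), LocallyRectifiable γ ∧
      (∀ ρ : Hat (P.Dom j) → ℝ≥0∞, Measurable ρ → lineIntegral ρ γ ≤ ∑ k ∈ Finset.Icc 1 j,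
        ∫⁻ x in Icc (P.segStart j k) (P.segEnd j k),
          {z : ℂ | (z : Sphere) ∈ P.Dom j}.indicator (fun z => ρ (proj (P.Dom j) z))
            (hline (P.height k t) x)) ∧
      ∀ p ∈ components (P.Dom j) ∩ range γ, ∃ i ∈ P.labels j, t ∈ P.hitSet j i ∧
        ∃ z ∈ P.piece j i, p = proj (P.Dom j) (z : Sphere) := by
  have hj1 : 1 ≤ j := hj₀.trans hj
  have hle : ∀ k, 1 ≤ k → k ≤ j → P.segStart j k < P.segEnd j k := fun k hk hkj =>
    (hP.segStart_bounds hk hkj).2.trans_lt (hP.segEnd_bounds hk hkj).1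
  have hends : ∀ k, 1 ≤ k → k + 1 ≤ j → P.segEnd j (k + 1) < P.segStart j k := by
    intro k hk hkj
    exact ((hP.seg_subset_gap (by omega) hkj (right_mem_Icc.2 (hle _ (by omega) hkj).le)).2.trans_lt
      (hP.hi_succ_lt_lo k)).trans (hP.segStart_bounds hk (by omega)).1
  have hlab : ∀ k, 1 ≤ k → k ≤ j → Label.chain k ℓ ∈ P.labels j := fun k hk hkj =>
    Or.inr (Or.inr (Or.inr ⟨k, ℓ, rfl, hk, hkj, hℓ, hℓ'⟩))
  have hpiece : ∀ k, 2 ≤ k → P.piece j (.chain k ℓ) = closure (P.U k j ℓ) := fun k hk => by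
    show P.Ubar k j ℓ = _
    rw [Ubar, if_neg (by omega)]
  have hend : ∀ k, 2 ≤ k → k ≤ j →
      hline (P.height k t) (P.segEnd j k) ∈ P.piece j (.chain k ℓ) := fun k hk hkj => by
    rw [hpiece k hk]
    exact hP.qw_sub_U k j ℓ hk hkj hℓ hℓ' (hP.mem_qwInfl_segEnd hj1 (by omega) ht)
  have hstart : ∀ k, 1 ≤ k → k + 1 ≤ j →
      hline (P.height k t) (P.segStart j k) ∈ P.piece j (.chain (k + 1) ℓ) := fun k hk hkj => by
    rw [hpiece (k + 1) (by omega)]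
    exact hP.qe_sub_U (k + 1) j ℓ (by omega) hkj hℓ hℓ' (hP.mem_qeInfl_segStart hkj ht)
  -- The path runs from gap `j` to gap `1`, so its segment number `i` lies in gap `j - i`. The
  -- passage from number `i` to `i + 1` goes around $Q_{k+1}$ with `k = j - (i + 1)`.
  have hidx : ∀ i, i < j - 1 → ∃ k, 1 ≤ k ∧ k + 1 ≤ j ∧ j - i = k + 1 ∧ j - (i + 1) = k :=
    fun i hi => ⟨j - (i + 1), by omega, by omega, by omega, rfl⟩
  obtain ⟨γ, hγ0, hγ1, hrect, hint, hcomp⟩ := exists_path_of_segments (G := P.Dom j)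
    (fun i => P.segStart j (j - i)) (fun i => P.segEnd j (j - i)) (fun i => P.height (j - i) t)
    (j - 1) (fun i hi => (hle _ (by omega) (by omega)).le) (fun i hi => by
      obtain ⟨k, hk, hkj, e1, e2⟩ := hidx i hi
      simp only [e1, e2]
      exact hends k hk hkj) (by
      have e : j - (j - 1) = 1 := by omega
      simp only [e, Nat.sub_zero]
      rcases hj1.lt_or_eq with h | rfl
      · exact ((hP.seg_subset_gap hj1 le_rfl (left_mem_Icc.2 (hle _ hj1 le_rfl).le)).2.trans_lt
          (hP.hi_lt_lo le_rfl h)).trans ((hP.segStart_bounds le_rfl hj1).1.trans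
            (hle _ le_rfl hj1))
      · exact hle 1 le_rfl le_rfl) (fun i hi => by
      obtain ⟨k, hk, hkj, e1, e2⟩ := hidx i hi
      simp only [e1, e2]
      exact hP.proj_eq_of_mem_piece (hlab (k + 1) (by omega) hkj) (hend (k + 1) (by omega) hkj)
        (hstart k hk hkj)) (fun i hi => by
      obtain ⟨k, hk, hkj, e1, -⟩ := hidx i hi
      simp only [e1]
      exact P.coe_notMem_Dom_iff.2 ⟨_, hlab (k + 1) (by omega) hkj, hend (k + 1) (by omega) hkj⟩)
    (hP.measurableSet_Dom j)
  have e : j - (j - 1) = 1 := by omega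
  simp only [e, Nat.sub_zero] at hγ0 hγ1
  refine ⟨γ, ⟨⟨_, ⟨_, ?_, rfl⟩, hγ0.symm⟩, ⟨_, ⟨_, ?_, rfl⟩, hγ1.symm⟩⟩, hrect, ?_, ?_⟩
  -- The end points lie on the sides of $Q_{0,j}$ and $Q_{1,j}$. These squares shrink with $j$, so
  -- the points are in the squares of stage $j_0$.
  · have h1 := hP.T₀_anti hj₀ hj
    have h2 := hP.T₀_pos j hj1
    have h3 := hP.R_succ_pos j
    have h4 := hP.abs_height_le j ht'
    refine mem_Q₀.2 ⟨?_, ?_⟩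
    · show |P.segStart j j| ≤ _
      rw [segStart, if_pos rfl, abs_of_nonneg (by linarith)]
      exact h1
    · show |P.height j t| ≤ _
      linarith
  · have h1 := hP.T_anti le_rfl hj
    have h2 := hP.R_lt_T le_rfl j
    have h3 := hP.R_pos 1 le_rfl
    have h4 := hP.abs_height_le 1 ht'
    have h5 := hP.R_succ_le le_rfl
    refine mem_Q.2 ⟨?_, ?_⟩
    · show _ ≤ P.segEnd j 1 ∧ P.segEnd j 1 ≤ _
      rw [segEnd, if_pos rfl]
      constructor <;> linarith
    · show |P.height 1 t| ≤ _
      linarith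
  · intro ρ hρ
    refine (hint ρ hρ).trans_eq ?_
    rw [Nat.sub_add_cancel hj1]
    refine Finset.sum_nbij' (fun i => j - i) (fun k => j - k) ?_ ?_ ?_ ?_ ?_
    · intro i hi
      rw [Finset.mem_range] at hi
      exact Finset.mem_Icc.2 ⟨by omega, by omega⟩
    · intro k hk
      rw [Finset.mem_Icc] at hk
      exact Finset.mem_range.2 (by omega)
    · intro i hi
      rw [Finset.mem_range] at hi
      omega
    · intro k hk
      rw [Finset.mem_Icc] at hk
      omega
    · exact fun _ _ => rfl
  · intro p hp
    obtain ⟨i, hi, x, hx, hxG, rfl⟩ := hcomp p hp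
    obtain ⟨n, hn, hxn⟩ := P.coe_notMem_Dom_iff.1 hxG
    exact ⟨n, hn, hP.mem_hitSet (by omega) (by omega) hn hx hxn, _, hxn, rfl⟩

/-- The contribution of the gaps to the length–area estimate. -/
theorem sum_lintegral_segments_le {j : ℕ} (hj : 1 ≤ j) {F : ℂ → ℝ≥0∞} (hF : Measurable F) :
    ∑ k ∈ Finset.Icc 1 j, ∫⁻ t in P.goodHeights j, ∫⁻ x in Icc (P.segStart j k) (P.segEnd j k),
      F (hline (P.height k t) x) ≤ 9 * (∫⁻ z, F z ^ 2) + ENNReal.ofReal (1 / 72) := by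
  have hk : ∀ k ∈ Finset.Icc 1 j, ∫⁻ t in P.goodHeights j,
      ∫⁻ x in Icc (P.segStart j k) (P.segEnd j k), F (hline (P.height k t) x) ≤
      9 * (∫⁻ z in Complex.re ⁻¹' Icc (P.segStart j k) (P.segEnd j k), F z ^ 2)
        + ENNReal.ofReal ((1 / 2) ^ k / 72) := by
    intro k hk
    obtain ⟨hk1, hkj⟩ := Finset.mem_Icc.1 hk
    refine lintegral_segments_le hF (hP.R_succ_pos k) ?_ (hP.volume_goodHeights_le hj)
    rw [← hP.gap_eq k hk1]
    have h1 := hP.segStart_bounds hk1 hkj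
    have h2 := hP.segEnd_bounds hk1 hkj
    have h3 := hP.R_lt_T hk1 j
    have h4 := P.hi_eq k
    rw [hi] at h4
    linarith [h2.2.1]
  refine (Finset.sum_le_sum hk).trans ?_
  rw [Finset.sum_add_distrib, ← Finset.mul_sum, ← lintegral_biUnion_finset,
    ← ENNReal.ofReal_sum_of_nonneg fun k _ => by positivity]
  · refine add_le_add (mul_le_mul_right (setLIntegral_le_lintegral _ _) _)
      (ENNReal.ofReal_le_ofReal ?_)
    rw [← Finset.sum_div]
    linarith [sum_half_pow_le j]
  · intro k hk k' hk' hne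
    obtain ⟨hk1, hkj⟩ := Finset.mem_Icc.1 (Finset.mem_coe.1 hk)
    obtain ⟨hk1', hkj'⟩ := Finset.mem_Icc.1 (Finset.mem_coe.1 hk')
    refine disjoint_left.2 fun z hz hz' => hne ?_
    exact hP.gap_index_unique hk1 hk1' (hP.seg_subset_gap hk1 hkj hz)
      (hP.seg_subset_gap hk1' hkj' hz')
  · exact fun _ _ => Complex.measurable_re measurableSet_Icc

/-- The admissibility inequality of the path at height `t` is integrated over `t`. The gaps leave a
remainder of $\frac1{72}$ and the components one of $\frac7{36}$, together less than $\frac14$. -/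
theorem half_le_mass {j₀ j : ℕ} (hj₀ : 1 ≤ j₀) (hj : j₀ ≤ j) {ρ : Hat (P.Dom j) → ℝ≥0∞}
    (hρ : Admissible (joining (onSphere (P.Q₀ j₀)) (onSphere (P.Q 1 j₀)) (P.Dom j)) ρ) :
    ENNReal.ofReal (1 / 2) ≤ 9 * mass ρ + ENNReal.ofReal (1 / 4) := by
  classical
  have hj1 : 1 ≤ j := hj₀.trans hj
  have hG := hP.measurableSet_Dom j
  choose! z hz using fun i (hi : i ∈ P.labels j) => hP.nonempty_piece hj1 hi
  set pt : Label → Hat (P.Dom j) := fun i => proj (P.Dom j) (z i : Sphere) with hpt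
  have hinj : InjOn pt (P.labelFinset j) := by
    intro i hi i' hi' h
    by_contra hne
    rw [Finset.mem_coe, mem_labelFinset] at hi hi'
    exact hP.proj_ne_of_mem_piece hj1 hi hi' hne (hz i hi) (hz i' hi') h
  set F : ℂ → ℝ≥0∞ := {z : ℂ | (z : Sphere) ∈ P.Dom j}.indicator fun z => ρ (proj (P.Dom j) z)
    with hF
  have hFm : Measurable F :=
    (hρ.1.comp ((continuous_proj _).comp OnePoint.continuous_coe).measurable).indicator hG
  set g : ℕ → ℝ → ℝ≥0∞ := fun k t =>
    ∫⁻ x in Icc (P.segStart j k) (P.segEnd j k), F (hline (P.height k t) x) with hg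
  have hgm : ∀ k, Measurable (g k) := by
    intro k
    have hline2 : Measurable fun p : ℝ × ℝ => hline (P.height k p.1) p.2 :=
      Complex.measurableEquivRealProd.symm.measurable.comp
        (measurable_snd.prodMk (by fun_prop))
    exact (hFm.comp hline2).lintegral_prod_right'
  -- The components on the path are among the pieces whose hit set contains `t`. The indicators make
  -- the sum measurable in `t`, so that it can be integrated term by term.
  have hpoint : ∀ t ∈ P.goodHeights j, 1 ≤ ∑ k ∈ Finset.Icc 1 j, g k t
      + ∑ i ∈ P.labelFinset j, (P.hitSet j i).indicator (fun _ => ρ (pt i)) t := by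
    intro t ht
    have ht' := hP.goodHeights_subset hj1 ht
    obtain ⟨ℓ, hℓ, htℓ⟩ := mem_iUnion₂.1 ht
    obtain ⟨hℓ1, hℓM⟩ := Finset.mem_Icc.1 hℓ
    obtain ⟨γ, hγ, hrect, hint, hcomp⟩ := hP.exists_joining_path hj₀ hj hℓ1 hℓM htℓ ht'
    refine (hρ.2 γ hγ hrect).trans (add_le_add (hint ρ hρ.1) ?_)
    set S := (P.labelFinset j).filter fun i => t ∈ P.hitSet j i with hS
    have hsub : components (P.Dom j) ∩ range γ ⊆ ((S.image pt : Finset _) : Set _) := by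
      intro p hp
      obtain ⟨i, hi, hti, w, hw, rfl⟩ := hcomp p hp
      rw [Finset.mem_coe, Finset.mem_image]
      exact ⟨i, Finset.mem_filter.2 ⟨P.mem_labelFinset.2 hi, hti⟩,
        hP.proj_eq_of_mem_piece hi (hz i hi) hw⟩
    refine (ENNReal.tsum_mono_subtype ρ hsub).trans ?_
    rw [Finset.tsum_subtype' (S.image pt) ρ,
      Finset.sum_image fun i hi i' hi' h => hinj (Finset.mem_of_mem_filter i hi)
        (Finset.mem_of_mem_filter i' hi') h, Finset.sum_filter]
    exact (Finset.sum_congr rfl fun i _ => by rw [indicator_apply]).le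
  have hgood := P.measurableSet_goodHeights j
  have hhit : ∀ i ∈ P.labelFinset j,
      ∫⁻ t in P.goodHeights j, (P.hitSet j i).indicator (fun _ => ρ (pt i)) t ≤
      9 * ρ (pt i) ^ 2 + ENNReal.ofReal (P.weight j i ^ 2 / 36) := by
    intro i hi
    have hi' := P.mem_labelFinset.1 hi
    rw [lintegral_indicator_const (P.measurableSet_hitSet j i),
      Measure.restrict_apply (P.measurableSet_hitSet j i)]
    refine (mul_le_mul_right (hP.volume_hit_le hj1 hi') _).trans ?_
    simpa using ennreal_mul_le_sq (ρ (pt i)) (y := P.weight j i) one_pos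
  have hsumpt : ∑ i ∈ P.labelFinset j, ρ (pt i) ^ 2 ≤
      ∑' p : ↥(components (P.Dom j)), ρ p ^ 2 := by
    have hsub : (((P.labelFinset j).image pt : Finset _) : Set _) ⊆ components (P.Dom j) := by
      intro p hp
      obtain ⟨i, hi, rfl⟩ := Finset.mem_image.1 (Finset.mem_coe.1 hp)
      have hi' := P.mem_labelFinset.1 hi
      exact proj_mem_components_iff.2 (P.coe_notMem_Dom_iff.2 ⟨i, hi', hz i hi'⟩)
    refine le_trans ?_ (ENNReal.tsum_mono_subtype (fun p => ρ p ^ 2) hsub)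
    rw [Finset.tsum_subtype' ((P.labelFinset j).image pt) (fun p => ρ p ^ 2),
      Finset.sum_image hinj]
  have hsumF : ∫⁻ z, F z ^ 2 = ∫⁻ z in {z : ℂ | (z : Sphere) ∈ P.Dom j}, ρ (proj (P.Dom j) z) ^ 2 := by
    rw [← lintegral_indicator hG]
    refine lintegral_congr fun z => ?_
    rw [hF, indicator_apply, indicator_apply]
    split_ifs
    · rfl
    · exact zero_pow two_ne_zero
  calc ENNReal.ofReal (1 / 2) ≤ volume (P.goodHeights j) := hP.volume_goodHeights_ge hj1
    _ = ∫⁻ _ in P.goodHeights j, 1 := (setLIntegral_one _).symm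
    _ ≤ ∫⁻ t in P.goodHeights j, (∑ k ∈ Finset.Icc 1 j, g k t
          + ∑ i ∈ P.labelFinset j, (P.hitSet j i).indicator (fun _ => ρ (pt i)) t) :=
        setLIntegral_mono' hgood hpoint
    _ = ∑ k ∈ Finset.Icc 1 j, (∫⁻ t in P.goodHeights j, g k t)
          + ∑ i ∈ P.labelFinset j, ∫⁻ t in P.goodHeights j,
            (P.hitSet j i).indicator (fun _ => ρ (pt i)) t := by
        rw [lintegral_add_left (Finset.measurable_fun_sum _ fun k _ => hgm k),
          lintegral_finsetSum _ fun k _ => hgm k, lintegral_finsetSum _ fun i _ =>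
            measurable_const.indicator (P.measurableSet_hitSet j i)]
    _ ≤ (9 * (∫⁻ z, F z ^ 2) + ENNReal.ofReal (1 / 72))
          + (9 * (∑ i ∈ P.labelFinset j, ρ (pt i) ^ 2) + ENNReal.ofReal (7 / 36)) := by
        refine add_le_add (hP.sum_lintegral_segments_le hj1 hFm) ((Finset.sum_le_sum hhit).trans ?_)
        rw [Finset.sum_add_distrib, ← Finset.mul_sum,
          ← ENNReal.ofReal_sum_of_nonneg fun i _ => by positivity, ← Finset.sum_div]
        refine add_le_add le_rfl (ENNReal.ofReal_le_ofReal ?_)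
        linarith [hP.sum_weight_sq_le hj1]
    _ = 9 * ((∫⁻ z, F z ^ 2) + ∑ i ∈ P.labelFinset j, ρ (pt i) ^ 2)
          + ENNReal.ofReal (1 / 72 + 7 / 36) := by
        rw [ENNReal.ofReal_add (by norm_num) (by norm_num)]
        ring
    _ ≤ 9 * mass ρ + ENNReal.ofReal (1 / 4) := by
        rw [hsumF]
        refine add_le_add (mul_le_mul_right (add_le_add le_rfl hsumpt) _)
          (ENNReal.ofReal_le_ofReal (by norm_num))

end IsConstruction

end Data

end SquareDomain

theorem proposition3p2 (P : SquareDomain.Data) (hP : P.IsConstruction) (j₀ j : ℕ)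
    (hj₀ : 1 ≤ j₀) (hj : j₀ ≤ j) :
    (1 / 36 : ℝ≥0∞) ≤ Transboundary.modBetween
      (Transboundary.onSphere (P.Q₀ j₀)) (Transboundary.onSphere (P.Q 1 j₀)) (P.Dom j) := by
  refine le_iInf₂ fun ρ hρ => ?_
  have h := hP.half_le_mass hj₀ hj hρ
  by_cases hm : Transboundary.mass ρ = ∞
  · rw [hm]
    exact le_top
  · obtain ⟨r, hr, hrm⟩ : ∃ r : ℝ, 0 ≤ r ∧ Transboundary.mass ρ = ENNReal.ofReal r :=
      ⟨_, ENNReal.toReal_nonneg, (ENNReal.ofReal_toReal hm).symm⟩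
    have h9 : (9 : ℝ≥0∞) = ENNReal.ofReal 9 := by simp
    have h36 : (1 / 36 : ℝ≥0∞) = ENNReal.ofReal (1 / 36) := by
      rw [ENNReal.ofReal_div_of_pos (by norm_num)]
      simp
    rw [hrm, h9, ← ENNReal.ofReal_mul (by norm_num),
      ← ENNReal.ofReal_add (by positivity) (by norm_num),
      ENNReal.ofReal_le_ofReal_iff (by positivity)] at h
    rw [hrm, h36]
    exact ENNReal.ofReal_le_ofReal (by linarith)
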